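/- Let $G$ be a complete graph on $n$ vertices whose edges have weights $\pm1$. The number of disagreements of a partition of the vertices into clusters is the number of positive edges between different clusters plus the number of negative edges inside clusters; $\mathsf{OPT}$ is its minimum over all partitions. Let $0<\epsilon\le 1$. ClusterWild! draws a uniformly random order $\pi$ of the vertices and works in rounds until every vertex is clustered. In a round, let $V$ be the set of unclustered vertices and $\Delta$ the maximum number of positive neighbours that a vertex of $V$ has in $V$. The first $\max(1,\lfloor\epsilon |V|/\Delta\rfloor)$ vertices of $V$ in the order $\pi$ (all of $V$ if $\Delta=0$) are active. Every active vertex becomes the center of a cluster of its own, even if it has active positive neighbours; every other vertex of $V$ with at least one active positive neighbour joins the cluster of the first such neighbour in the order $\pi$; then the clustered vertices are removed. Theorem. There is an absolute constant $C$ such that for all $n$, $G$ and $\epsilon$ as above, the expected number of disagreements (with respect to $G$, over the random $\pi$) of the clustering output by ClusterWild! is at most $$(3+\epsilon)\cdot\mathsf{OPT}+C\cdot\epsilon\cdot n\cdot\log^2 n .$$ -/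

import Mathlib

/-!
A complete graph with weights `±1` on the vertex set `Fin n` is given by the simple graph `G` of its
positive edges: distinct `u`, `v` are joined by a `+1` edge if `G.Adj u v`, and by a `-1` edge
otherwise.
-/

namespace CorrelationClustering

/-- The number of disagreements of a clustering. A clustering is given by labels, its clusters being
the nonempty sets of vertices with a common label. Counted are the unordered pairs `{u, v}`,
`u ≠ v` (listed with `u < v`) that are joined by a positive edge and cut by the clustering, or
joined by a negative edge inside a cluster. -/
def disagreements {n : ℕ} {α : Type*} [DecidableEq α] (G : SimpleGraph (Fin n))
    [DecidableRel G.Adj] (c : Fin n → α) : ℕ :=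
  (Finset.univ.filter (fun p : Fin n × Fin n =>
    p.1 < p.2 ∧ ((G.Adj p.1 p.2 ∧ c p.1 ≠ c p.2) ∨ (¬ G.Adj p.1 p.2 ∧ c p.1 = c p.2)))).card

/-- The minimum number of disagreements over all partitions of the vertices (a partition of `n`
vertices has at most `n` parts, so labels in `Fin n` suffice). -/
def OPT {n : ℕ} (G : SimpleGraph (Fin n)) [DecidableRel G.Adj] : ℕ :=
  Finset.univ.inf' ⟨id, Finset.mem_univ id⟩ (fun c : Fin n → Fin n => disagreements G c)

/-- The state of ClusterWild! between two rounds: the set of the vertices that are still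
unclustered, and the array `clusterID`, where `⊤` stands for `∞`. -/
structure State (n : ℕ) where
  alive : Finset (Fin n)
  clusterID : Fin n → WithTop (Fin n)

/-- Initially all vertices are present and all cluster IDs are `∞`. -/
def initState (n : ℕ) : State n := ⟨Finset.univ, fun _ => ⊤⟩

/-- The maximum positive degree of the graph induced on the vertex set `S`. -/
def maxDegreeOn {n : ℕ} (G : SimpleGraph (Fin n)) [DecidableRel G.Adj] (S : Finset (Fin n)) : ℕ :=
  S.sup (fun v => (S.filter (fun u => G.Adj v u)).card)

/-- The number of active vertices of a round in which `S` is the set of unclustered vertices: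
`ε * |S| / Δ` rounded down, but at least `1`, with `Δ` the maximum positive degree of the graph
induced on `S`; all vertices of `S` if `Δ = 0`. -/
noncomputable def batchSize {n : ℕ} (G : SimpleGraph (Fin n)) [DecidableRel G.Adj] (ε : ℝ)
    (S : Finset (Fin n)) : ℕ :=
  if maxDegreeOn G S = 0 then S.card
  else max 1 ⌊ε * (S.card : ℝ) / (maxDegreeOn G S : ℝ)⌋₊

/-- The first `b` vertices of `S` in the order `π`, where `π v` is the position of the
vertex `v`. -/
def firstVertices {n : ℕ} (π : Equiv.Perm (Fin n)) (b : ℕ) (S : Finset (Fin n)) :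
    Finset (Fin n) :=
  S.filter (fun v => (S.filter (fun u => π u < π v)).card < b)

/-- The array `clusterID` after `createCluster(v)` was executed, in whatever order, for all vertices
`v` of the active set `A`, where `S` is the set of unclustered vertices at the start of the round:
every `v ∈ A` gets `clusterID(v) = π(v)`, and every other `u ∈ S` gets the minimum of its
former value and of all `π(v)`, where `v ∈ A` is a positive neighbour of `u`. -/
def updateIDs {n : ℕ} (G : SimpleGraph (Fin n)) [DecidableRel G.Adj] (π : Equiv.Perm (Fin n))
    (S A : Finset (Fin n)) (ids : Fin n → WithTop (Fin n)) : Fin n → WithTop (Fin n) :=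
  fun u =>
    if u ∈ A then (π u : WithTop (Fin n))
    else if u ∈ S then
      min (ids u) ((A.filter (fun v => G.Adj v u)).inf (fun v => (π v : WithTop (Fin n))))
    else ids u

/-- One round of ClusterWild!: take the active set from the prefix of `π` restricted to the
unclustered vertices, make all active vertices cluster centers, and remove the clustered vertices. -/
noncomputable def round {n : ℕ} (G : SimpleGraph (Fin n)) [DecidableRel G.Adj] (ε : ℝ)
    (π : Equiv.Perm (Fin n)) (s : State n) : State n :=
  let A := firstVertices π (batchSize G ε s.alive) s.alive
  let ids := updateIDs G π s.alive A s.clusterID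
  ⟨s.alive.filter (fun v => ids v = ⊤), ids⟩

/-- The clustering output by ClusterWild! with the vertex order `π`. The loop runs until no
unclustered vertex is left; this is the case after at most `n` rounds
(`round_iterate_alive`), and further rounds change nothing (`round_of_alive_eq_empty`). -/
noncomputable def clusterWild {n : ℕ} (G : SimpleGraph (Fin n)) [DecidableRel G.Adj] (ε : ℝ)
    (π : Equiv.Perm (Fin n)) : Fin n → WithTop (Fin n) :=
  ((round G ε π)^[n] (initState n)).clusterID

/-- The expected number of disagreements of the output of ClusterWild!, where `π` is a uniformly
random permutation. -/
noncomputable def expectedCost {n : ℕ} (G : SimpleGraph (Fin n)) [DecidableRel G.Adj] (ε : ℝ) :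
    ℝ :=
  (∑ π : Equiv.Perm (Fin n), (disagreements G (clusterWild G ε π) : ℝ)) /
    (Fintype.card (Equiv.Perm (Fin n)) : ℝ)

theorem round_of_alive_eq_empty {n : ℕ} (G : SimpleGraph (Fin n)) [DecidableRel G.Adj] (ε : ℝ)
    (π : Equiv.Perm (Fin n)) (s : State n) (hs : s.alive = ∅) : round G ε π s = s := by
  cases s with
  | mk S ids =>
    simp only at hs
    subst hs
    simp only [round, firstVertices, Finset.filter_empty, State.mk.injEq, true_and]
    funext u
    simp [updateIDs]

theorem one_le_batchSize {n : ℕ} (G : SimpleGraph (Fin n)) [DecidableRel G.Adj] (ε : ℝ)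
    (S : Finset (Fin n)) (hS : S.Nonempty) : 1 ≤ batchSize G ε S := by
  unfold batchSize
  split_ifs
  · exact hS.card_pos
  · exact le_max_left _ _

theorem round_alive_ssubset {n : ℕ} (G : SimpleGraph (Fin n)) [DecidableRel G.Adj] (ε : ℝ)
    (π : Equiv.Perm (Fin n)) (s : State n) (hs : s.alive.Nonempty) :
    (round G ε π s).alive ⊂ s.alive := by
  obtain ⟨v, hv, hmin⟩ := Finset.exists_min_image s.alive π hs
  refine Finset.filter_ssubset.2 ⟨v, hv, ?_⟩
  have hA : v ∈ firstVertices π (batchSize G ε s.alive) s.alive := by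
    refine Finset.mem_filter.2 ⟨hv, ?_⟩
    have h0 : s.alive.filter (fun u => π u < π v) = ∅ :=
      Finset.filter_eq_empty_iff.2 fun u hu => not_lt.2 (hmin u hu)
    rw [h0, Finset.card_empty]
    exact one_le_batchSize G ε s.alive hs
  simp [updateIDs, hA]

theorem round_iterate_alive {n : ℕ} (G : SimpleGraph (Fin n)) [DecidableRel G.Adj] (ε : ℝ)
    (π : Equiv.Perm (Fin n)) : ((round G ε π)^[n] (initState n)).alive = ∅ := by
  have key : ∀ k : ℕ, ((round G ε π)^[k] (initState n)).alive.card ≤ n - k := by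
    intro k
    induction k with
    | zero => simp [initState]
    | succ k ih =>
      rw [Function.iterate_succ_apply']
      rcases Finset.eq_empty_or_nonempty ((round G ε π)^[k] (initState n)).alive with h | h
      · rw [round_of_alive_eq_empty G ε π _ h, h]
        simp
      · have := Finset.card_lt_card (round_alive_ssubset G ε π _ h)
        omega
  have := key n
  simpa using this

end CorrelationClustering

/-! The proof gives `(3 + ε) * OPT + 5 / 2 * (ε * n)` (`expectedCost_le`); the logarithms only enter
in the last step. The analysis goes round by round. Fix the set `S` of vertices alive before a
round. Exchanging two vertices of `S` in the order does not affect earlier rounds, so the orders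
leading to `S` are closed under such exchanges (`swapInvariant_aliveAfter`), and all probabilities
in the round are compared by exchanging vertices.

A disagreement of the output that is decided in this round is of one of three kinds
(`ExtendsRound.decided_le`): a positive edge between two active vertices; a positive edge from an
active vertex to a non-active one that has a second active neighbour; or a pair `u`, `w` of
non-active vertices. The batch size makes the first two kinds rare: their expected number is at most
a multiple of `ε` times the expected number of vertices clustered in the round, and these numbers
add up to `n`.

For the third kind, the earliest vertex `p` in the closed neighbourhood of `u` and `w` is active and
forms a bad triple (two positive edges, one negative) with them. An arbitrary clustering `c`
disagrees with an edge of every bad triple. If that edge is `t₁t₂`, the chances that `t₁` or `t₂` is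
the pivot of the triple add up to at most `2 + ε` times the chance for `t₀`
(`BadTriple.pivotCount_add_le`). Hence all three are paid for, with factor `3 + ε`, by the event
that `t₀` is the pivot, in which case the edge `t₁t₂` is decided in this round. A pair has at most
one pivot, so no disagreement of `c` is charged twice.

The loss is `ε` and not `2 * ε` because the two error sums in `cnt_first_add_le` are bounded by
disjoint parts of one event. -/

namespace CorrelationClustering

open Finset Equiv

/-! ### Indicators -/

open Classical in
/-- The indicator of a proposition, as a real number. -/
noncomputable def ind (p : Prop) : ℝ := if p then 1 else 0

theorem ind_of {p : Prop} (h : p) : ind p = 1 := if_pos h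

theorem ind_of_not {p : Prop} (h : ¬ p) : ind p = 0 := if_neg h

theorem ind_nonneg (p : Prop) : 0 ≤ ind p := by
  by_cases h : p
  · simp [ind_of h]
  · simp [ind_of_not h]

theorem ind_mono {p q : Prop} (h : p → q) : ind p ≤ ind q := by
  by_cases hp : p
  · rw [ind_of hp, ind_of (h hp)]
  · rw [ind_of_not hp]; exact ind_nonneg q

theorem ind_congr {p q : Prop} (h : p ↔ q) : ind p = ind q :=
  le_antisymm (ind_mono h.1) (ind_mono h.2)

theorem ind_and (p q : Prop) : ind (p ∧ q) = ind p * ind q := by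
  by_cases hp : p
  · rw [ind_of hp, one_mul]; exact ind_congr (by tauto)
  · rw [ind_of_not hp, zero_mul, ind_of_not (by tauto)]

theorem ind_le_sum {α : Type*} {s : Finset α} {p : Prop} {q : α → Prop}
    (h : p → ∃ i ∈ s, q i) : ind p ≤ ∑ i ∈ s, ind (q i) := by
  by_cases hp : p
  · obtain ⟨i, hi, hq⟩ := h hp
    rw [ind_of hp, ← ind_of hq]
    exact single_le_sum (f := fun i => ind (q i)) (fun j _ => ind_nonneg _) hi
  · rw [ind_of_not hp]
    exact sum_nonneg fun j _ => ind_nonneg _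

theorem sum_ind_le {α : Type*} {s : Finset α} {p : Prop} {q : α → Prop}
    (h : ∀ i ∈ s, q i → p) (hu : ∀ i ∈ s, ∀ j ∈ s, q i → q j → i = j) :
    ∑ i ∈ s, ind (q i) ≤ ind p := by
  by_cases hq : ∃ i ∈ s, q i
  · obtain ⟨i, hi, hqi⟩ := hq
    rw [ind_of (h i hi hqi), ← ind_of hqi]
    refine (sum_eq_single_of_mem i hi fun j hj hji => ?_).le
    exact ind_of_not fun hqj => hji (hu j hj i hi hqj hqi)
  · rw [sum_eq_zero fun i hi => ind_of_not fun h' => hq ⟨i, hi, h'⟩]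
    exact ind_nonneg p

theorem sum_ind_eq_card {α : Type*} (s : Finset α) (q : α → Prop) [DecidablePred q] :
    ∑ i ∈ s, ind (q i) = (s.filter q).card := by
  rw [card_filter, Nat.cast_sum]
  refine sum_congr rfl fun i _ => ?_
  by_cases h : q i <;> simp [ind, h]

theorem ind_le_add {p q r : Prop} (h : p → q ∨ r) : ind p ≤ ind q + ind r := by
  have hq := ind_nonneg q
  have hr := ind_nonneg r
  by_cases hp : p
  · rw [ind_of hp]
    rcases h hp with h | h
    · rw [ind_of h]; linarith
    · rw [ind_of h]; linarith
  · rw [ind_of_not hp]; linarith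

theorem ind_add_le {p q r : Prop} (hp : p → r) (hq : q → r) (h : p → ¬ q) :
    ind p + ind q ≤ ind r := by
  by_cases h' : p
  · rw [ind_of_not (h h'), add_zero]; exact ind_mono hp
  · rw [ind_of_not h', zero_add]; exact ind_mono hq

/-! ### Counting orders; ranks and exchanges -/

section Orders

variable {n : ℕ}

/-- The number of orders in `F` that have the property `P`. -/
noncomputable def cnt (F : Finset (Perm (Fin n))) (P : Perm (Fin n) → Prop) : ℝ :=
  ∑ π ∈ F, ind (P π)

/-- `F` is closed under exchanging the positions of two elements of `S`. -/
def SwapInvariant (F : Finset (Perm (Fin n))) (S : Finset (Fin n)) : Prop :=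
  ∀ π ∈ F, ∀ x ∈ S, ∀ y ∈ S, π * swap x y ∈ F

/-- The number of elements of `S` that precede `v` in the order `π`. -/
def rk (S : Finset (Fin n)) (π : Perm (Fin n)) (v : Fin n) : ℕ :=
  (S.filter fun u => π u < π v).card

/-- No element of `Q` precedes `p` in the order `π`. -/
def First (Q : Finset (Fin n)) (π : Perm (Fin n)) (p : Fin n) : Prop :=
  ∀ q ∈ Q, π p ≤ π q

variable {F : Finset (Perm (Fin n))} {S : Finset (Fin n)}

theorem cnt_nonneg (P : Perm (Fin n) → Prop) : 0 ≤ cnt F P :=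
  sum_nonneg fun _ _ => ind_nonneg _

theorem cnt_mono {P Q : Perm (Fin n) → Prop} (h : ∀ π ∈ F, P π → Q π) : cnt F P ≤ cnt F Q :=
  sum_le_sum fun π hπ => ind_mono (h π hπ)

theorem cnt_le_sum {α : Type*} {s : Finset α} {P : Perm (Fin n) → Prop}
    {Q : α → Perm (Fin n) → Prop} (h : ∀ π ∈ F, P π → ∃ i ∈ s, Q i π) :
    cnt F P ≤ ∑ i ∈ s, cnt F (Q i) := by
  unfold cnt
  rw [sum_comm]
  exact sum_le_sum fun π hπ => ind_le_sum (h π hπ)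

theorem sum_cnt_le {α : Type*} {s : Finset α} {P : Perm (Fin n) → Prop}
    {Q : α → Perm (Fin n) → Prop} (h : ∀ π ∈ F, ∀ i ∈ s, Q i π → P π)
    (hu : ∀ π ∈ F, ∀ i ∈ s, ∀ j ∈ s, Q i π → Q j π → i = j) :
    ∑ i ∈ s, cnt F (Q i) ≤ cnt F P := by
  unfold cnt
  rw [sum_comm]
  exact sum_le_sum fun π hπ => sum_ind_le (h π hπ) (hu π hπ)

theorem sum_mul_swap (hF : SwapInvariant F S) {x y : Fin n} (hx : x ∈ S) (hy : y ∈ S)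
    (g : Perm (Fin n) → ℝ) : ∑ π ∈ F, g (π * swap x y) = ∑ π ∈ F, g π :=
  sum_nbij' (· * swap x y) (· * swap x y) (fun π hπ => hF π hπ x hx y hy)
    (fun π hπ => hF π hπ x hx y hy) (fun π _ => by simp [mul_assoc])
    (fun π _ => by simp [mul_assoc]) (fun π _ => rfl)

/-- The exchange is a bijection of `F`. This replaces every use of uniform randomness below. -/
theorem cnt_le_of_swap (hF : SwapInvariant F S) {x y : Fin n} (hx : x ∈ S) (hy : y ∈ S)
    {P Q : Perm (Fin n) → Prop} (h : ∀ π ∈ F, P (π * swap x y) → Q π) : cnt F P ≤ cnt F Q := by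
  unfold cnt
  rw [← sum_mul_swap hF hx hy]
  exact sum_le_sum fun π hπ => ind_mono (h π hπ)

theorem swap_mem_iff {Q : Finset (Fin n)} {x y : Fin n} (hx : x ∈ Q) (hy : y ∈ Q) (q : Fin n) :
    swap x y q ∈ Q ↔ q ∈ Q := by
  rcases eq_or_ne q x with rfl | h1
  · simp [hx, hy]
  rcases eq_or_ne q y with rfl | h2
  · simp [hx, hy]
  rw [swap_apply_of_ne_of_ne h1 h2]

theorem rk_mul_swap {x y : Fin n} (hx : x ∈ S) (hy : y ∈ S) (π : Perm (Fin n)) (v : Fin n) :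
    rk S (π * swap x y) v = rk S π (swap x y v) := by
  refine card_nbij' (swap x y) (swap x y) ?_ ?_ (fun _ _ => by simp) (fun _ _ => by simp)
  · intro u hu
    obtain ⟨h1, h2⟩ := mem_filter.1 (mem_coe.1 hu)
    exact mem_coe.2 (mem_filter.2 ⟨(swap_mem_iff hx hy u).2 h1, h2⟩)
  · intro u hu
    obtain ⟨h1, h2⟩ := mem_filter.1 (mem_coe.1 hu)
    exact mem_coe.2 (mem_filter.2 ⟨(swap_mem_iff hx hy u).2 h1, by simpa using h2⟩)

theorem first_mul_swap {Q : Finset (Fin n)} {x y : Fin n} (hx : x ∈ Q) (hy : y ∈ Q)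
    (π : Perm (Fin n)) (v : Fin n) : First Q (π * swap x y) v ↔ First Q π (swap x y v) := by
  constructor
  · intro h q hq
    simpa using h (swap x y q) ((swap_mem_iff hx hy q).2 hq)
  · intro h q hq
    simpa using h (swap x y q) ((swap_mem_iff hx hy q).2 hq)

theorem First.mono {Q Q' : Finset (Fin n)} (h : Q ⊆ Q') {π : Perm (Fin n)} {p : Fin n}
    (hp : First Q' π p) : First Q π p := fun q hq => hp q (h hq)

theorem rk_mono (S : Finset (Fin n)) {π : Perm (Fin n)} {u v : Fin n} (h : π u ≤ π v) :
    rk S π u ≤ rk S π v :=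
  card_le_card (monotone_filter_right _ fun _ _ hw => lt_of_lt_of_le hw h)

theorem rk_lt {π : Perm (Fin n)} {u v : Fin n} (hu : u ∈ S) (h : π u < π v) :
    rk S π u < rk S π v := by
  refine card_lt_card (ssubset_iff_of_subset ?_ |>.2 ⟨u, ?_, ?_⟩)
  · exact monotone_filter_right _ fun _ _ hw => lt_trans hw h
  · exact mem_filter.2 ⟨hu, h⟩
  · simp

theorem rk_lt_iff {π : Perm (Fin n)} {u v : Fin n} (hu : u ∈ S) :
    rk S π u < rk S π v ↔ π u < π v :=
  ⟨fun h => lt_of_not_ge fun h' => absurd (rk_mono S h') (not_le.2 h), rk_lt hu⟩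

theorem rk_injOn (S : Finset (Fin n)) (π : Perm (Fin n)) : Set.InjOn (rk S π) S := by
  intro u hu v hv h
  by_contra hne
  rcases lt_or_gt_of_ne (fun h' => hne (π.injective h') : π u ≠ π v) with h' | h'
  · exact absurd h (rk_lt hu h').ne
  · exact absurd h (rk_lt hv h').ne'

theorem rk_lt_card {π : Perm (Fin n)} {v : Fin n} (hv : v ∈ S) : rk S π v < S.card :=
  card_lt_card (filter_ssubset.2 ⟨v, hv, lt_irrefl _⟩)

theorem image_rk (S : Finset (Fin n)) (π : Perm (Fin n)) : S.image (rk S π) = range S.card := by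
  refine eq_of_subset_of_card_le ?_ ?_
  · intro j hj
    obtain ⟨v, hv, rfl⟩ := mem_image.1 hj
    exact mem_range.2 (rk_lt_card hv)
  · rw [card_image_of_injOn (rk_injOn S π), card_range]

theorem exists_rk_eq (π : Perm (Fin n)) {j : ℕ} (hj : j < S.card) : ∃ e ∈ S, rk S π e = j := by
  have : j ∈ S.image (rk S π) := by rw [image_rk]; exact mem_range.2 hj
  simpa using this

theorem card_rk_lt (π : Perm (Fin n)) {b : ℕ} (hb : b ≤ S.card) :
    (S.filter fun v => rk S π v < b).card = b := by
  rw [← card_image_of_injOn ((rk_injOn S π).mono (coe_subset.2 (filter_subset _ S)))]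
  conv_rhs => rw [← card_range b]
  congr 1
  ext j
  simp only [mem_image, mem_filter, mem_range]
  constructor
  · rintro ⟨v, ⟨-, h⟩, rfl⟩
    exact h
  · intro hj
    obtain ⟨v, hv, rfl⟩ := exists_rk_eq π (hj.trans_le hb)
    exact ⟨v, ⟨hv, hj⟩, rfl⟩

theorem rk_erase (S : Finset (Fin n)) (π : Perm (Fin n)) (z v : Fin n) (hz : z ∈ S) :
    rk (S.erase z) π v + (if π z < π v then 1 else 0) = rk S π v := by
  unfold rk
  rw [filter_erase]
  split_ifs with h
  · exact card_erase_add_one (mem_filter.2 ⟨hz, h⟩)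
  · rw [erase_eq_of_notMem (by simp [h]), add_zero]

end Orders

/-! ### Moving one vertex through the order -/

section Insertion

variable {n : ℕ} {F : Finset (Perm (Fin n))} {S : Finset (Fin n)}

/-- Exchanging two elements of consecutive ranks does not change the order of the others with
respect to each other, nor with respect to the one that takes the place of `z`. -/
theorem lt_mul_swap_iff {π : Perm (Fin n)} {z e : Fin n} (hz : z ∈ S) (he : e ∈ S) {j : ℕ}
    (hej : rk S π e = j) (hzj : rk S π z = j + 1) {a c : Fin n} (ha : a ∈ S.erase z)
    (hc : c ∈ S.erase z) : (π * swap z e) a < (π * swap z e) c ↔ π a < π c := by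
  obtain ⟨haz, ha⟩ := mem_erase.1 ha
  obtain ⟨hcz, hc⟩ := mem_erase.1 hc
  have key : ∀ d ∈ S, d ≠ e → rk S π d ≠ j := fun d hd hne h =>
    hne (rk_injOn S π hd he (h.trans hej.symm))
  have key' : ∀ d ∈ S, d ≠ z → rk S π d ≠ j + 1 := fun d hd hne h =>
    hne (rk_injOn S π hd hz (h.trans hzj.symm))
  rw [← rk_lt_iff (S := S) ha, ← rk_lt_iff (S := S) ha, rk_mul_swap hz he, rk_mul_swap hz he]
  rcases eq_or_ne a e with rfl | hae <;> rcases eq_or_ne c a with rfl | hca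
  · simp
  · rw [swap_apply_right, swap_apply_of_ne_of_ne hcz hca]
    have := key c hc hca
    have := key' c hc hcz
    omega
  · simp
  · rcases eq_or_ne c e with rfl | hce
    · rw [swap_apply_right, swap_apply_of_ne_of_ne haz hae]
      have := key a ha hae
      have := key' a ha haz
      omega
    · rw [swap_apply_of_ne_of_ne haz hae, swap_apply_of_ne_of_ne hcz hce]

/-- Exchange `z` with whichever vertex has the next rank. The other conditions only involve the
order on `S.erase z`, which this preserves. -/
theorem cnt_rk_le_succ (hF : SwapInvariant F S) {z p : Fin n} (hz : z ∈ S)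
    (hp : p ∈ S.erase z) {Q : Finset (Fin n)} (hQ : Q ⊆ S.erase z) (m j : ℕ)
    (hj : j + 1 < S.card) :
    cnt F (fun π => rk S π z = j ∧ rk (S.erase z) π p < m ∧ First Q π p) ≤
      cnt F (fun π => rk S π z = j + 1 ∧ rk (S.erase z) π p < m ∧ First Q π p) := by
  calc _ ≤ ∑ e ∈ S, cnt F (fun π => (rk S π z = j ∧ rk (S.erase z) π p < m ∧ First Q π p) ∧
            rk S π e = j + 1) := by
        refine cnt_le_sum fun π _ h => ?_
        obtain ⟨e, he, hr⟩ := exists_rk_eq π hj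
        exact ⟨e, he, h, hr⟩
    _ ≤ ∑ e ∈ S, cnt F (fun π => (rk S π z = j + 1 ∧ rk (S.erase z) π p < m ∧ First Q π p) ∧
            rk S π e = j) := by
        refine sum_le_sum fun e he => cnt_le_of_swap hF hz he fun π _ h => ?_
        obtain ⟨⟨h1, h2, h3⟩, h4⟩ := h
        rw [rk_mul_swap hz he, swap_apply_left] at h1
        rw [rk_mul_swap hz he, swap_apply_right] at h4
        refine ⟨⟨h4, ?_, fun q hq => ?_⟩, h1⟩
        · refine lt_of_eq_of_lt ?_ h2
          unfold rk
          congr 1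
          exact filter_congr fun u hu => (lt_mul_swap_iff hz he h1 h4 hu hp).symm
        · have := h3 q hq
          rw [← not_lt] at this ⊢
          rwa [lt_mul_swap_iff hz he h1 h4 (hQ hq) hp] at this
    _ ≤ _ := sum_cnt_le (fun π _ e _ h => h.1) fun π _ e he e' he' h h' =>
        rk_injOn S π he he' (h.2.trans h'.2.symm)

/-- Among the orders in which `p` is the first element of `R` apart from `z` and has a small rank,
the rank of `z` is uniformly distributed. -/
theorem cnt_first_erase_le (hF : SwapInvariant F S) {z p : Fin n} (hz : z ∈ S) (hp : p ∈ S)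
    (hpz : p ≠ z) {R : Finset (Fin n)} (hR : R ⊆ S) {b : ℕ} (hb : 1 ≤ b) (hbS : b ≤ S.card) :
    ((S.card : ℝ) - b + 1) *
        cnt F (fun π => First (R.erase z) π p ∧ rk S π p < b ∧ rk S π z < b) ≤
      b * cnt F (fun π => rk S π p < b ∧ First R π p) := by
  -- The rank of `p` is counted without `z`, so that the condition on `p` does not depend on the
  -- place of `z`. When both ranks in `S` are below `b`, this rank is below `b - 1`, whichever of
  -- the two comes first.
  set N : ℕ → ℝ := fun j => cnt F (fun π => rk S π z = j ∧ rk (S.erase z) π p < b - 1 ∧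
    First (R.erase z) π p) with hN
  have hp' : p ∈ S.erase z := mem_erase.2 ⟨hpz, hp⟩
  have hmono : ∀ i j, i ≤ j → j < S.card → N i ≤ N j := by
    intro i j hij
    induction j, hij using Nat.le_induction with
    | base => exact fun _ => le_rfl
    | succ j _ ih =>
      exact fun hj => (ih (by omega)).trans
        (cnt_rk_le_succ hF hz hp' (erase_subset_erase z hR) _ j hj)
  have hV : cnt F (fun π => First (R.erase z) π p ∧ rk S π p < b ∧ rk S π z < b) ≤
      b * N (b - 1) := by
    calc _ ≤ ∑ j ∈ range b, N j := by
          refine cnt_le_sum fun π _ h => ⟨rk S π z, mem_range.2 h.2.2, rfl, ?_, h.1⟩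
          have h1 := rk_erase S π z p hz
          split_ifs at h1 with h2
          · omega
          · have : rk S π p < rk S π z :=
              rk_lt hp (lt_of_le_of_ne (not_lt.1 h2) fun h' => hpz (π.injective h'))
            omega
      _ ≤ ∑ j ∈ range b, N (b - 1) := by
          refine sum_le_sum fun j hj => hmono _ _ ?_ (by omega)
          have := mem_range.1 hj
          omega
      _ = b * N (b - 1) := by simp
  -- If `z` has one of the `S.card - b + 1` ranks from `b - 1` on, then `p` precedes `z` and is
  -- therefore first in all of `R`.
  have hf : ((S.card : ℝ) - b + 1) * N (b - 1) ≤
      cnt F (fun π => rk S π p < b ∧ First R π p) := by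
    calc ((S.card : ℝ) - b + 1) * N (b - 1) = ∑ j ∈ Ico (b - 1) S.card, N (b - 1) := by
          rw [sum_const, Nat.card_Ico, nsmul_eq_mul, Nat.cast_sub (by omega), Nat.cast_sub hb]
          push_cast
          ring
      _ ≤ ∑ j ∈ Ico (b - 1) S.card, N j := by
          refine sum_le_sum fun j hj => ?_
          obtain ⟨h1, h2⟩ := mem_Ico.1 hj
          exact hmono _ _ h1 h2
      _ ≤ _ := by
          refine sum_cnt_le (fun π _ j hj h => ?_) fun π _ i _ j _ h h' => h.1.symm.trans h'.1
          obtain ⟨h1, h2, h3⟩ := h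
          have hj := (mem_Ico.1 hj).1
          have h4 := rk_erase S π z p hz
          have h5 : ¬ π z < π p := by
            intro h5
            have := rk_lt hz h5
            rw [if_pos h5] at h4
            omega
          rw [if_neg h5] at h4
          refine ⟨by omega, fun q hq => ?_⟩
          rcases eq_or_ne q z with rfl | hqz
          · exact not_lt.1 h5
          · exact h3 q (mem_erase.2 ⟨hqz, hq⟩)
  have h1 : (0 : ℝ) ≤ (S.card : ℝ) - b + 1 := by
    have : (b : ℝ) ≤ S.card := by exact_mod_cast hbS
    linarith
  calc _ ≤ ((S.card : ℝ) - b + 1) * (b * N (b - 1)) := mul_le_mul_of_nonneg_left hV h1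
    _ = b * (((S.card : ℝ) - b + 1) * N (b - 1)) := by ring
    _ ≤ _ := mul_le_mul_of_nonneg_left hf (Nat.cast_nonneg b)

end Insertion

/-! ### Being first in two sets and in their union -/

section TwoSets

variable {n : ℕ} {F : Finset (Perm (Fin n))} {S R₁ R₂ : Finset (Fin n)} {p : Fin n}

/-- In the first event, either `p` is first in the union apart from `z` (`E₁`), or some other
element of `R₁` precedes `p`. Exchanging `p` and `z` turns the latter into `E₂`, which is disjoint
from the second event, as there `z` is first in `R₁.erase p`. Both lie in "`p` is first and `z` is
active", which is disjoint from `E₁`, where `z` is first. -/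
theorem first_union_add_le (hF : SwapInvariant F S) (hR₁ : R₁ ⊆ S) (hp : p ∈ S)
    (hp₂ : p ∈ R₂) (b : ℕ) {z : Fin n} (hz₁ : z ∈ R₁) (hz₂ : z ∉ R₂) :
    cnt F (fun π => First (R₁ ∪ R₂) π z ∧ rk S π p < b ∧ First R₂ π p) +
        cnt F (fun π => First (R₁ ∪ R₂) π p ∧ rk S π z < b ∧ First (R₁.erase p) π z) ≤
      cnt F (fun π => First ((R₁ ∪ R₂).erase z) π p ∧ rk S π p < b ∧ rk S π z < b) := by
  have hpz : p ≠ z := fun h => hz₂ (h ▸ hp₂)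
  have hz : z ∈ S := hR₁ hz₁
  have hzR : z ∈ R₁ ∪ R₂ := mem_union_left _ hz₁
  have hpR : p ∈ R₁ ∪ R₂ := mem_union_right _ hp₂
  set E₁ : Perm (Fin n) → Prop := fun π =>
    First (R₁ ∪ R₂) π z ∧ rk S π p < b ∧ First ((R₁ ∪ R₂).erase z) π p with hE₁
  set E₂ : Perm (Fin n) → Prop := fun π =>
    First (R₁ ∪ R₂) π p ∧ rk S π z < b ∧ ∃ r ∈ R₁, r ≠ p ∧ r ≠ z ∧ π r < π z with hE₂
  have h1 : cnt F (fun π => First (R₁ ∪ R₂) π z ∧ rk S π p < b ∧ First R₂ π p) ≤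
      cnt F E₁ + cnt F E₂ := by
    have h2 : cnt F (fun π => First (R₁ ∪ R₂) π z ∧ rk S π p < b ∧
        ∃ r ∈ R₁, r ≠ p ∧ r ≠ z ∧ π r < π p) ≤ cnt F E₂ := by
      refine cnt_le_of_swap hF hz hp fun π _ h => ?_
      obtain ⟨h1, h2, r, hr, hrp, hrz, h3⟩ := h
      rw [first_mul_swap hzR hpR, swap_apply_left] at h1
      rw [rk_mul_swap hz hp, swap_apply_right] at h2
      refine ⟨h1, h2, r, hr, hrp, hrz, ?_⟩
      simpa [swap_apply_of_ne_of_ne hrz hrp] using h3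
    refine le_trans ?_ (add_le_add_right h2 _)
    unfold cnt
    rw [← sum_add_distrib]
    refine sum_le_sum fun π _ => ind_le_add fun h => ?_
    obtain ⟨h1, h2, h3⟩ := h
    by_cases h4 : First ((R₁ ∪ R₂).erase z) π p
    · exact Or.inl ⟨h1, h2, h4⟩
    · unfold First at h4
      push Not at h4
      obtain ⟨r, hr, h5⟩ := h4
      obtain ⟨hrz, hr⟩ := mem_erase.1 hr
      rcases mem_union.1 hr with hr | hr
      · exact Or.inr ⟨h1, h2, r, hr, fun h => h5.ne (h ▸ rfl), hrz, h5⟩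
      · exact absurd (h3 r hr) (not_le.2 h5)
  refine (add_le_add_left h1 _).trans ?_
  unfold cnt
  rw [← sum_add_distrib, ← sum_add_distrib]
  refine sum_le_sum fun π _ => ?_
  have h2 : ind (E₂ π) +
      ind (First (R₁ ∪ R₂) π p ∧ rk S π z < b ∧ First (R₁.erase p) π z) ≤
      ind (First (R₁ ∪ R₂) π p ∧ rk S π z < b) := by
    refine ind_add_le (fun h => ⟨h.1, h.2.1⟩) (fun h => ⟨h.1, h.2.1⟩) ?_
    rintro ⟨-, -, r, hr, hrp, -, h3⟩ ⟨-, -, h4⟩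
    exact absurd (h4 r (mem_erase.2 ⟨hrp, hr⟩)) (not_le.2 h3)
  rw [add_assoc]
  refine (add_le_add_right h2 _).trans (ind_add_le ?_ ?_ ?_)
  · rintro ⟨h3, h4, h5⟩
    exact ⟨h5, h4, (rk_mono S (h3 p hpR)).trans_lt h4⟩
  · rintro ⟨h3, h4⟩
    exact ⟨h3.mono (erase_subset _ _), (rk_mono S (h3 z hzR)).trans_lt h4, h4⟩
  · rintro ⟨h3, -, -⟩ ⟨h4, -⟩
    exact hpz (π.injective (le_antisymm (h4 z hzR) (h3 p hpR)))

/-- Exchange `p` with `w`, then `w` with `z`. The bound does not depend on `w`, and its right side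
is the second event of `first_union_add_le`. -/
theorem first_union_le_of_mem_sdiff (hF : SwapInvariant F S) (hR₁ : R₁ ⊆ S) (hR₂ : R₂ ⊆ S)
    (hp₁ : p ∈ R₁) (hp₂ : p ∈ R₂) (b : ℕ) {z w : Fin n} (hz₁ : z ∈ R₁) (hz₂ : z ∉ R₂)
    (hw₂ : w ∈ R₂) (hw₁ : w ∉ R₁) :
    cnt F (fun π => First (R₁ ∪ R₂) π w ∧ rk S π p < b ∧ First R₁ π p) ≤
      cnt F (fun π => First (R₁ ∪ R₂) π p ∧ rk S π z < b ∧ First (R₁.erase p) π z) := by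
  have hpw : p ≠ w := fun h => hw₁ (h ▸ hp₁)
  have hpz : p ≠ z := fun h => hz₂ (h ▸ hp₂)
  have hzR : z ∈ R₁ ∪ R₂ := mem_union_left _ hz₁
  have hwR : w ∈ R₁ ∪ R₂ := mem_union_right _ hw₂
  have hpR : p ∈ R₁ ∪ R₂ := mem_union_right _ hp₂
  calc _ ≤ cnt F (fun π => First (R₁ ∪ R₂) π p ∧ rk S π w < b ∧ First (R₁.erase p) π w) := by
        refine cnt_le_of_swap hF (hR₁ hp₁) (hR₂ hw₂) fun π _ h => ?_
        obtain ⟨h1, h2, h3⟩ := h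
        rw [first_mul_swap hpR hwR, swap_apply_right] at h1
        rw [rk_mul_swap (hR₁ hp₁) (hR₂ hw₂), swap_apply_left] at h2
        refine ⟨h1, h2, fun q hq => ?_⟩
        obtain ⟨hqp, hq⟩ := mem_erase.1 hq
        have hqw : q ≠ w := fun h => hw₁ (h ▸ hq)
        simpa [swap_apply_of_ne_of_ne hqp hqw] using h3 q hq
    _ ≤ _ := by
        refine cnt_le_of_swap hF (hR₂ hw₂) (hR₁ hz₁) fun π _ h => ?_
        obtain ⟨h1, h2, h3⟩ := h
        rw [first_mul_swap hwR hzR, swap_apply_of_ne_of_ne hpw hpz] at h1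
        rw [rk_mul_swap (hR₂ hw₂) (hR₁ hz₁), swap_apply_left] at h2
        refine ⟨h1, h2, fun q hq => ?_⟩
        rcases eq_or_ne q z with rfl | hqz
        · exact le_rfl
        · have hqw : q ≠ w := fun h => hw₁ (h ▸ (mem_erase.1 hq).2)
          simpa [swap_apply_of_ne_of_ne hqw hqz] using h3 q hq

theorem first_union_le_of_mem_sdiff' (hF : SwapInvariant F S) (hR₁ : R₁ ⊆ S)
    (hp₂ : p ∈ R₂) (b : ℕ) {z w : Fin n} (hz₁ : z ∈ R₁) (hz₂ : z ∉ R₂)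
    (hw₁ : w ∈ R₁) (hw₂ : w ∉ R₂) :
    cnt F (fun π => First (R₁ ∪ R₂) π w ∧ rk S π p < b ∧ First R₂ π p) ≤
      cnt F (fun π => First (R₁ ∪ R₂) π z ∧ rk S π p < b ∧ First R₂ π p) := by
  have hpw : p ≠ w := fun h => hw₂ (h ▸ hp₂)
  have hpz : p ≠ z := fun h => hz₂ (h ▸ hp₂)
  refine cnt_le_of_swap hF (hR₁ hw₁) (hR₁ hz₁) fun π _ h => ?_
  obtain ⟨h1, h2, h3⟩ := h
  rw [first_mul_swap (mem_union_left _ hw₁) (mem_union_left _ hz₁), swap_apply_left] at h1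
  rw [rk_mul_swap (hR₁ hw₁) (hR₁ hz₁), swap_apply_of_ne_of_ne hpw hpz] at h2
  refine ⟨h1, h2, fun q hq => ?_⟩
  have hqw : q ≠ w := fun h => hw₂ (h ▸ hq)
  have hqz : q ≠ z := fun h => hz₂ (h ▸ hq)
  simpa [swap_apply_of_ne_of_ne hpw hpz, swap_apply_of_ne_of_ne hqw hqz] using h3 q hq

/-- If `p` is first in `R₁` but not in the union, the first element `w` of the union lies in `R₂ \
R₁`. -/
theorem cnt_first_le_union (hp₁ : p ∈ R₁) (b : ℕ) :
    cnt F (fun π => rk S π p < b ∧ First R₁ π p) ≤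
      cnt F (fun π => rk S π p < b ∧ First (R₁ ∪ R₂) π p) +
        ∑ w ∈ R₂ \ R₁, cnt F (fun π => First (R₁ ∪ R₂) π w ∧ rk S π p < b ∧ First R₁ π p) := by
  unfold cnt
  rw [sum_comm, ← sum_add_distrib]
  refine sum_le_sum fun π _ => ?_
  by_cases h : First (R₁ ∪ R₂) π p
  · refine le_trans (ind_mono fun h' => ⟨h'.1, h⟩) (le_add_of_nonneg_right ?_)
    exact sum_nonneg fun _ _ => ind_nonneg _
  · refine le_trans (ind_le_sum fun h' => ?_) (le_add_of_nonneg_left (ind_nonneg _))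
    obtain ⟨w, hw, hmin⟩ := exists_min_image (R₁ ∪ R₂) π ⟨p, mem_union_left _ hp₁⟩
    refine ⟨w, mem_sdiff.2 ?_, hmin, h'⟩
    have hw₁ : w ∉ R₁ := fun hw₁ => h fun q hq => (h'.2 w hw₁).trans (hmin q hq)
    exact ⟨(mem_union.1 hw).resolve_left hw₁, hw₁⟩

/-- By `cnt_first_le_union` the excess over `2 * f` is at most the sum of all `α w` and `β w`. For a
fixed `z ∈ R₁ \ R₂`, each `α w` and each `β w` is at most one of the two counts in
`first_union_add_le`, so the two sums together cost only `K * V z`, which `cnt_first_erase_le`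
bounds by `ε * f`. -/
theorem cnt_first_add_le (hF : SwapInvariant F S) (hR₁ : R₁ ⊆ S) (hR₂ : R₂ ⊆ S)
    (hp₁ : p ∈ R₁) (hp₂ : p ∈ R₂) {b K : ℕ} {ε : ℝ} (hε : 0 ≤ ε) (hb1 : 1 ≤ b)
    (hbS : b ≤ S.card) (hb : b = 1 ∨ (K : ℝ) * b ≤ ε * ((S.card : ℝ) - b + 1))
    (hK₁ : (R₁ \ R₂).card ≤ K) (hK₂ : (R₂ \ R₁).card ≤ K) :
    cnt F (fun π => rk S π p < b ∧ First R₁ π p) + cnt F (fun π => rk S π p < b ∧ First R₂ π p) ≤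
      (2 + ε) * cnt F (fun π => rk S π p < b ∧ First (R₁ ∪ R₂) π p) := by
  set f := cnt F (fun π => rk S π p < b ∧ First (R₁ ∪ R₂) π p) with hf
  have hf0 : 0 ≤ f := cnt_nonneg _
  set α : Fin n → ℝ := fun w =>
    cnt F (fun π => First (R₁ ∪ R₂) π w ∧ rk S π p < b ∧ First R₁ π p) with hα
  set β : Fin n → ℝ := fun w =>
    cnt F (fun π => First (R₁ ∪ R₂) π w ∧ rk S π p < b ∧ First R₂ π p) with hβ
  set V : Fin n → ℝ := fun z =>
    cnt F (fun π => First ((R₁ ∪ R₂).erase z) π p ∧ rk S π p < b ∧ rk S π z < b) with hV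
  have hp : p ∈ S := hR₁ hp₁
  have h1 := cnt_first_le_union (F := F) (S := S) (R₂ := R₂) hp₁ b
  have h2 := cnt_first_le_union (F := F) (S := S) (R₂ := R₁) hp₂ b
  rw [union_comm R₂ R₁] at h2
  have hKV : ∀ z ∈ S, z ≠ p → K * V z ≤ ε * f := by
    intro z hz hzp
    -- With a single active vertex, `p` and `z` cannot both be active.
    rcases hb with rfl | hb
    · have : V z ≤ 0 := by
        refine (sum_nonpos fun π _ => (ind_of_not ?_).le)
        rintro ⟨-, h3, h4⟩
        exact hzp (rk_injOn S π hz hp (by omega))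
      exact (mul_nonpos_of_nonneg_of_nonpos (Nat.cast_nonneg K) this).trans (mul_nonneg hε hf0)
    · have h3 := cnt_first_erase_le hF hz hp hzp.symm (union_subset hR₁ hR₂) hb1 hbS
      have h4 : (0 : ℝ) < (S.card : ℝ) - b + 1 := by
        have : (b : ℝ) ≤ S.card := by exact_mod_cast hbS
        linarith
      refine le_of_mul_le_mul_left ?_ h4
      calc ((S.card : ℝ) - b + 1) * (K * V z) = K * (((S.card : ℝ) - b + 1) * V z) := by ring
        _ ≤ K * (b * f) := mul_le_mul_of_nonneg_left h3 (Nat.cast_nonneg K)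
        _ = (K * b) * f := by ring
        _ ≤ (ε * ((S.card : ℝ) - b + 1)) * f := mul_le_mul_of_nonneg_right hb hf0
        _ = ((S.card : ℝ) - b + 1) * (ε * f) := by ring
  have hsum : ∀ (A : Finset (Fin n)) (g : Fin n → ℝ) (c : ℝ), A.card ≤ K → 0 ≤ c →
      (∀ w ∈ A, g w ≤ c) → ∑ w ∈ A, g w ≤ K * c := by
    intro A g c hA hc hg
    calc ∑ w ∈ A, g w ≤ A.card • c := sum_le_card_nsmul _ _ _ hg
      _ = A.card * c := nsmul_eq_mul _ _
      _ ≤ K * c := mul_le_mul_of_nonneg_right (by exact_mod_cast hA) hc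
  have main : ∑ w ∈ R₂ \ R₁, α w + ∑ w ∈ R₁ \ R₂, β w ≤ ε * f := by
    rcases (R₁ \ R₂).eq_empty_or_nonempty with he | ⟨z, hz⟩
    -- Now there is no `β` sum, and the roles of `R₁` and `R₂` are exchanged to bound the `α` sum
    -- alone.
    · rw [he, sum_empty, add_zero]
      rcases (R₂ \ R₁).eq_empty_or_nonempty with he' | ⟨z, hz⟩
      · rw [he', sum_empty]
        exact mul_nonneg hε hf0
      · obtain ⟨hz₂, hz₁⟩ := mem_sdiff.1 hz
        refine le_trans (hsum _ α (V z) hK₂ (cnt_nonneg _) fun w hw => ?_)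
          (hKV z (hR₂ hz₂) fun h => hz₁ (h ▸ hp₁))
        obtain ⟨hw₂, hw₁⟩ := mem_sdiff.1 hw
        have h3 := first_union_le_of_mem_sdiff' hF hR₂ hp₁ b hz₂ hz₁ hw₂ hw₁
        have h4 := first_union_add_le hF hR₂ hp hp₁ b hz₂ hz₁
        rw [union_comm R₂ R₁] at h3 h4
        have h5 := cnt_nonneg (F := F)
          (fun π => First (R₁ ∪ R₂) π p ∧ rk S π z < b ∧ First (R₂.erase p) π z)
        simp only [hα, hV]
        linarith
    · obtain ⟨hz₁, hz₂⟩ := mem_sdiff.1 hz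
      have h4 := first_union_add_le hF hR₁ hp hp₂ b hz₁ hz₂
      have h5 := hsum _ α _ hK₂ (cnt_nonneg _) fun w hw => first_union_le_of_mem_sdiff hF hR₁ hR₂
        hp₁ hp₂ b hz₁ hz₂ (mem_sdiff.1 hw).1 (mem_sdiff.1 hw).2
      have h6 := hsum _ β _ hK₁ (cnt_nonneg _) fun w hw => first_union_le_of_mem_sdiff' hF hR₁
        hp₂ b hz₁ hz₂ (mem_sdiff.1 hw).1 (mem_sdiff.1 hw).2
      have h7 := hKV z (hR₁ hz₁) fun h => hz₂ (h ▸ hp₂)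
      have h8 := mul_le_mul_of_nonneg_left h4 (Nat.cast_nonneg (α := ℝ) K)
      rw [mul_add] at h8
      linarith
  linarith

end TwoSets

/-! ### Bad triples and their pivots -/

section Triples

variable {n : ℕ} {G : SimpleGraph (Fin n)}

/-- Exactly two of the edges between the three distinct vertices are positive. -/
def BadTriple (G : SimpleGraph (Fin n)) (a b c : Fin n) : Prop :=
  a ≠ b ∧ b ≠ c ∧ a ≠ c ∧ ((G.Adj a b ∧ G.Adj b c ∧ ¬ G.Adj a c) ∨
    (G.Adj a b ∧ G.Adj a c ∧ ¬ G.Adj b c) ∨ (G.Adj a c ∧ G.Adj b c ∧ ¬ G.Adj a b))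

/-- The distinct vertices `u`, `w` are joined by an edge with which the clustering `c` disagrees. -/
def Disagree {α : Type*} (G : SimpleGraph (Fin n)) (c : Fin n → α) (u w : Fin n) : Prop :=
  u ≠ w ∧ ((G.Adj u w ∧ c u ≠ c w) ∨ (¬ G.Adj u w ∧ c u = c w))

theorem BadTriple.swap_left {a b c : Fin n} (h : BadTriple G a b c) : BadTriple G b a c := by
  unfold BadTriple at *
  rw [G.adj_comm b a, ne_comm (a := b) (b := a)]
  tauto

theorem BadTriple.rotate {a b c : Fin n} (h : BadTriple G a b c) : BadTriple G c a b := by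
  unfold BadTriple at *
  rw [G.adj_comm c a, G.adj_comm c b, ne_comm (a := c) (b := b), ne_comm (a := c) (b := a)]
  tauto

theorem badTriple_swap_left_iff {a b c : Fin n} : BadTriple G a b c ↔ BadTriple G b a c :=
  ⟨BadTriple.swap_left, BadTriple.swap_left⟩

theorem badTriple_rotate_iff {a b c : Fin n} : BadTriple G a b c ↔ BadTriple G c a b :=
  ⟨BadTriple.rotate, fun h => h.rotate.rotate⟩

theorem Disagree.symm {α : Type*} {c : Fin n → α} {u w : Fin n} (h : Disagree G c u w) :
    Disagree G c w u := by
  unfold Disagree at *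
  rw [G.adj_comm w u, ne_comm (a := w), ne_comm (a := c w), eq_comm (a := c w)]
  exact h

/-- Lying in the same cluster is transitive. -/
theorem BadTriple.exists_disagree {α : Type*} (c : Fin n → α) {t₀ t₁ t₂ : Fin n}
    (h : BadTriple G t₀ t₁ t₂) :
    Disagree G c t₁ t₂ ∨ Disagree G c t₀ t₂ ∨ Disagree G c t₀ t₁ := by
  unfold BadTriple at h
  unfold Disagree
  obtain ⟨h1, h2, h3, h⟩ := h
  by_contra hcon
  rcases h with h | h | h <;> grind

variable [DecidableRel G.Adj] {F : Finset (Perm (Fin n))} {S : Finset (Fin n)}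

/-- The vertices of `S` that are `u`, `w` or a positive neighbour of one of them. -/
def closedNbhd (G : SimpleGraph (Fin n)) [DecidableRel G.Adj] (S : Finset (Fin n)) (u w : Fin n) :
    Finset (Fin n) :=
  S.filter fun q => q = u ∨ q = w ∨ G.Adj q u ∨ G.Adj q w

theorem closedNbhd_comm (u w : Fin n) : closedNbhd G S u w = closedNbhd G S w u :=
  filter_congr fun q _ => by tauto

theorem BadTriple.mem_closedNbhd {t₀ t₁ t₂ : Fin n} (h : BadTriple G t₀ t₁ t₂) (h₀ : t₀ ∈ S) :
    t₀ ∈ closedNbhd G S t₁ t₂ := by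
  unfold BadTriple at h
  exact mem_filter.2 ⟨h₀, by tauto⟩

theorem card_adj_le_maxDegreeOn {v : Fin n} (hv : v ∈ S) :
    (S.filter fun u => G.Adj v u).card ≤ maxDegreeOn G S :=
  le_sup (f := fun v => (S.filter fun u => G.Adj v u).card) hv

/-- The number of orders in which `p` is among the first `b` vertices of `S` and precedes all other
vertices in the closed neighbourhood of `u` and `w`. -/
noncomputable def pivotCount (G : SimpleGraph (Fin n)) [DecidableRel G.Adj]
    (F : Finset (Perm (Fin n))) (S : Finset (Fin n)) (b : ℕ) (p u w : Fin n) : ℝ :=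
  cnt F fun π => rk S π p < b ∧ First (closedNbhd G S u w) π p

theorem pivotCount_comm (b : ℕ) (p u w : Fin n) :
    pivotCount G F S b p u w = pivotCount G F S b p w u := by
  unfold pivotCount
  rw [closedNbhd_comm]

/-- The positive edges of the triple form a path, so `t₂` has a positive neighbour inside the
triple, hence in `R`. This saves the `1` that compensates for `b` in `S.card - b + 1`. -/
theorem BadTriple.card_sdiff_lt {t₀ t₁ t₂ : Fin n} (h : BadTriple G t₀ t₁ t₂) (h₀ : t₀ ∈ S)
    (h₁ : t₁ ∈ S) (h₂ : t₂ ∈ S) {R : Finset (Fin n)} (hR : {t₀, t₁, t₂} ⊆ R) :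
    ((S.filter fun q => q = t₀ ∨ q = t₁ ∨ q = t₂ ∨ G.Adj q t₂) \ R).card + 1 ≤
      maxDegreeOn G S := by
  obtain ⟨x, hx, hxR, hadj⟩ : ∃ x ∈ S, x ∈ R ∧ G.Adj t₂ x := by
    have hb := h
    unfold BadTriple at hb
    by_cases h' : G.Adj t₂ t₀
    · exact ⟨t₀, h₀, hR (by simp), h'⟩
    · exact ⟨t₁, h₁, hR (by simp), by rw [G.adj_comm t₀ t₂, G.adj_comm t₁ t₂] at hb; tauto⟩
  refine le_trans ?_ (card_adj_le_maxDegreeOn (G := G) h₂)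
  rw [← card_erase_add_one (s := S.filter fun u => G.Adj t₂ u) (a := x) (by simp [hx, hadj])]
  refine Nat.succ_le_succ (card_le_card fun q hq => ?_)
  obtain ⟨hq, hqR⟩ := mem_sdiff.1 hq
  obtain ⟨hqS, hq⟩ := mem_filter.1 hq
  have hq' : G.Adj q t₂ := by
    rcases hq with rfl | rfl | rfl | hq
    · exact absurd (hR (by simp)) hqR
    · exact absurd (hR (by simp)) hqR
    · exact absurd (hR (by simp)) hqR
    · exact hq
  exact mem_erase.2 ⟨fun h => hqR (h ▸ hxR), mem_filter.2 ⟨hqS, hq'.symm⟩⟩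

/-- Exchanging the pivot with `t₀` makes `t₀` first in the triple together with the neighbours of
`t₂` (set `R₁`), respectively of `t₁` (set `R₂`). The union of these sets is the closed
neighbourhood of `t₁` and `t₂`, so `cnt_first_add_le` applies. -/
theorem BadTriple.pivotCount_add_le (hF : SwapInvariant F S) {t₀ t₁ t₂ : Fin n}
    (h : BadTriple G t₀ t₁ t₂) (h₀ : t₀ ∈ S) (h₁ : t₁ ∈ S) (h₂ : t₂ ∈ S) {b : ℕ} {ε : ℝ}
    (hε : 0 ≤ ε) (hb1 : 1 ≤ b) (hbS : b ≤ S.card)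
    (hb : b = 1 ∨ ((maxDegreeOn G S : ℝ) - 1) * b ≤ ε * ((S.card : ℝ) - b + 1)) :
    pivotCount G F S b t₁ t₀ t₂ + pivotCount G F S b t₂ t₀ t₁ ≤
      (2 + ε) * pivotCount G F S b t₀ t₁ t₂ := by
  set R₁ := S.filter fun q => q = t₀ ∨ q = t₁ ∨ q = t₂ ∨ G.Adj q t₂ with hR₁
  set R₂ := S.filter fun q => q = t₀ ∨ q = t₂ ∨ q = t₁ ∨ G.Adj q t₁ with hR₂
  have hmem : ∀ (x y z : Fin n), BadTriple G x y z → x ∈ S → y ∈ S → z ∈ S → ∀ q ∈ S,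
      (q = x ∨ q = y ∨ q = z ∨ G.Adj q z) → q ∈ closedNbhd G S x z := by
    intro x y z hxyz hx hy hz q hq hqz
    rcases hqz with rfl | rfl | rfl | hqz
    · exact mem_filter.2 ⟨hq, Or.inl rfl⟩
    · exact hxyz.swap_left.mem_closedNbhd hq
    · exact mem_filter.2 ⟨hq, Or.inr (Or.inl rfl)⟩
    · exact mem_filter.2 ⟨hq, Or.inr (Or.inr (Or.inr hqz))⟩
  -- Both `x` and `y` lie in the closed neighbourhood of `x` and `z`, so exchanging them keeps it
  -- intact; the neighbours of `x` are then dropped.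
  have hstep : ∀ (x y z : Fin n), BadTriple G x y z → x ∈ S → y ∈ S → z ∈ S →
      pivotCount G F S b y x z ≤ cnt F (fun π => rk S π x < b ∧
        First (S.filter fun q => q = x ∨ q = y ∨ q = z ∨ G.Adj q z) π x) := by
    intro x y z hxyz hx hy hz
    refine cnt_le_of_swap hF hy hx fun π _ hπ => ?_
    obtain ⟨hπ1, hπ2⟩ := hπ
    rw [rk_mul_swap hy hx, swap_apply_left] at hπ1
    rw [first_mul_swap (hxyz.swap_left.mem_closedNbhd hy) (hmem x y z hxyz hx hy hz x hx
      (Or.inl rfl)), swap_apply_left] at hπ2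
    refine ⟨hπ1, fun q hq => hπ2 q ?_⟩
    exact hmem x y z hxyz hx hy hz q (mem_filter.1 hq).1 (mem_filter.1 hq).2
  have h' : BadTriple G t₀ t₂ t₁ := by
    unfold BadTriple at *
    rw [G.adj_comm t₂ t₁]
    tauto
  have hT₁ : {t₀, t₁, t₂} ⊆ R₁ := by
    intro q hq
    simp only [mem_insert, mem_singleton] at hq
    refine mem_filter.2 ⟨?_, by tauto⟩
    rcases hq with rfl | rfl | rfl <;> assumption
  have hT₂ : {t₀, t₁, t₂} ⊆ R₂ := by
    intro q hq
    simp only [mem_insert, mem_singleton] at hq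
    refine mem_filter.2 ⟨?_, by tauto⟩
    rcases hq with rfl | rfl | rfl <;> assumption
  have hK₁ := h.card_sdiff_lt h₀ h₁ h₂ hT₂
  have hK₂ := h'.card_sdiff_lt h₀ h₂ h₁ (R := R₁) (by rwa [pair_comm t₂ t₁])
  have hcast : ((maxDegreeOn G S - 1 : ℕ) : ℝ) = (maxDegreeOn G S : ℝ) - 1 := by
    rw [Nat.cast_sub (by omega)]
    simp
  have key := cnt_first_add_le hF (filter_subset _ _ : R₁ ⊆ S) (filter_subset _ _ : R₂ ⊆ S)
    (hT₁ (by simp : t₀ ∈ _)) (hT₂ (by simp : t₀ ∈ _)) (b := b) (K := maxDegreeOn G S - 1) hε hb1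
    hbS (by rwa [hcast]) (Nat.le_sub_of_add_le hK₁) (Nat.le_sub_of_add_le hK₂)
  have hunion : cnt F (fun π => rk S π t₀ < b ∧ First (R₁ ∪ R₂) π t₀) ≤
      pivotCount G F S b t₀ t₁ t₂ := by
    refine cnt_mono fun π _ hπ => ⟨hπ.1, hπ.2.mono fun q hq => ?_⟩
    obtain ⟨hqS, hq⟩ := mem_filter.1 hq
    rw [mem_union, hR₁, hR₂, mem_filter, mem_filter]
    tauto
  calc _ ≤ _ := add_le_add (hstep t₀ t₁ t₂ h h₀ h₁ h₂) (hstep t₀ t₂ t₁ h' h₀ h₂ h₁)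
    _ ≤ _ := key
    _ ≤ _ := mul_le_mul_of_nonneg_left hunion (by linarith)

theorem sum_pivotCount_le {α : Type*} (hF : SwapInvariant F S) {b : ℕ} {ε : ℝ}
    (hε : 0 ≤ ε) (hb1 : 1 ≤ b) (hbS : b ≤ S.card)
    (hb : b = 1 ∨ ((maxDegreeOn G S : ℝ) - 1) * b ≤ ε * ((S.card : ℝ) - b + 1))
    (c : Fin n → α) :
    ∑ p ∈ S, ∑ u ∈ S, ∑ w ∈ S, ind (BadTriple G p u w) * pivotCount G F S b p u w ≤
      (3 + ε) * ∑ p ∈ S, ∑ u ∈ S, ∑ w ∈ S,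
        ind (BadTriple G p u w) * (ind (Disagree G c u w) * pivotCount G F S b p u w) := by
  -- Averaging over the three choices of the pivot reduces the claim to a single bad triple.
  have hsymm : ∀ g : Fin n → Fin n → Fin n → ℝ,
      3 * ∑ p ∈ S, ∑ u ∈ S, ∑ w ∈ S, ind (BadTriple G p u w) * g p u w =
        ∑ p ∈ S, ∑ u ∈ S, ∑ w ∈ S,
          ind (BadTriple G p u w) * (g p u w + g u p w + g w p u) := by
    intro g
    have h1 : ∑ p ∈ S, ∑ u ∈ S, ∑ w ∈ S, ind (BadTriple G p u w) * g u p w =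
        ∑ p ∈ S, ∑ u ∈ S, ∑ w ∈ S, ind (BadTriple G p u w) * g p u w := by
      rw [sum_comm]
      refine sum_congr rfl fun p _ => sum_congr rfl fun u _ => sum_congr rfl fun w _ => ?_
      rw [ind_congr badTriple_swap_left_iff]
    have h2 : ∑ p ∈ S, ∑ u ∈ S, ∑ w ∈ S, ind (BadTriple G p u w) * g w p u =
        ∑ p ∈ S, ∑ u ∈ S, ∑ w ∈ S, ind (BadTriple G p u w) * g p u w := by
      calc _ = ∑ p ∈ S, ∑ w ∈ S, ∑ u ∈ S, ind (BadTriple G p u w) * g w p u :=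
            sum_congr rfl fun p _ => sum_comm
        _ = ∑ w ∈ S, ∑ p ∈ S, ∑ u ∈ S, ind (BadTriple G p u w) * g w p u := sum_comm
        _ = _ := by
            refine sum_congr rfl fun p _ => sum_congr rfl fun u _ => sum_congr rfl fun w _ => ?_
            rw [ind_congr badTriple_rotate_iff]
    simp only [mul_add, sum_add_distrib]
    rw [h1, h2]
    ring
  have h3 : (0 : ℝ) < 3 := by norm_num
  refine le_of_mul_le_mul_left ?_ h3
  rw [hsymm (fun p u w => pivotCount G F S b p u w), ← mul_assoc, mul_comm 3 (3 + ε), mul_assoc,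
    hsymm (fun p u w => ind (Disagree G c u w) * pivotCount G F S b p u w), mul_sum]
  refine sum_le_sum fun p hp => ?_
  rw [mul_sum]
  refine sum_le_sum fun u hu => ?_
  rw [mul_sum]
  refine sum_le_sum fun w hw => ?_
  by_cases h : BadTriple G p u w
  · rw [ind_of h, one_mul, one_mul]
    have hx : 0 ≤ pivotCount G F S b p u w := cnt_nonneg _
    have hy : 0 ≤ pivotCount G F S b u p w := cnt_nonneg _
    have hz : 0 ≤ pivotCount G F S b w p u := cnt_nonneg _
    have hd : ∀ q : Prop, ∀ x : ℝ, 0 ≤ x → 0 ≤ (3 + ε) * (ind q * x) := fun q x hx =>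
      mul_nonneg (by linarith) (mul_nonneg (ind_nonneg q) hx)
    have k1 := hd (Disagree G c u w) _ hx
    have k2 := hd (Disagree G c p w) _ hy
    have k3 := hd (Disagree G c p u) _ hz
    rw [mul_add, mul_add]
    rcases h.exists_disagree c with h' | h' | h'
    · have := h.pivotCount_add_le hF hp hu hw hε hb1 hbS hb
      rw [ind_of h', one_mul]
      linarith
    · have := h.swap_left.pivotCount_add_le hF hu hp hw hε hb1 hbS hb
      rw [pivotCount_comm b w u p] at this
      rw [ind_of h', one_mul]
      linarith
    · have := h.rotate.pivotCount_add_le hF hw hp hu hε hb1 hbS hb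
      rw [pivotCount_comm b p w u, pivotCount_comm b u w p] at this
      rw [ind_of h', one_mul]
      linarith
  · rw [ind_of_not h, zero_mul, zero_mul, mul_zero]

end Triples

/-! ### Disagreements decided in one round -/

section Round

variable {n : ℕ} {G : SimpleGraph (Fin n)} [DecidableRel G.Adj]

/-- The vertices of `S` that are still unclustered after a round with batch size `b`. -/
def survivors (G : SimpleGraph (Fin n)) [DecidableRel G.Adj] (b : ℕ) (π : Perm (Fin n))
    (S : Finset (Fin n)) : Finset (Fin n) :=
  S.filter fun v => v ∉ firstVertices π b S ∧ ∀ a ∈ firstVertices π b S, ¬ G.Adj a v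

/-- The labelling `c` agrees with the clusters that are created in a round starting from the set `S`
of unclustered vertices, and later clusters get other labels. -/
structure ExtendsRound {n : ℕ} (G : SimpleGraph (Fin n)) [DecidableRel G.Adj] (b : ℕ)
    (S : Finset (Fin n)) (π : Perm (Fin n)) (c : Fin n → WithTop (Fin n)) : Prop where
  active : ∀ u ∈ firstVertices π b S, c u = (π u : WithTop (Fin n))
  joined : ∀ u ∈ S, u ∉ firstVertices π b S → ∀ v ∈ firstVertices π b S, G.Adj v u →
    ∃ a ∈ firstVertices π b S, G.Adj a u ∧ π a ≤ π v ∧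
      (∀ a' ∈ firstVertices π b S, G.Adj a' u → π a ≤ π a') ∧ c u = (π a : WithTop (Fin n))
  survived : ∀ u ∈ survivors G b π S, ∃ a ∈ survivors G b π S, c u = (π a : WithTop (Fin n))

theorem mem_firstVertices {b : ℕ} {π : Perm (Fin n)} {S : Finset (Fin n)} {v : Fin n} :
    v ∈ firstVertices π b S ↔ v ∈ S ∧ rk S π v < b := mem_filter

theorem survivors_subset (b : ℕ) (π : Perm (Fin n)) (S : Finset (Fin n)) :
    survivors G b π S ⊆ S := filter_subset _ _

theorem mem_survivors_or {b : ℕ} {π : Perm (Fin n)} {S : Finset (Fin n)} {v : Fin n}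
    (hv : v ∈ S) (hA : v ∉ firstVertices π b S) :
    v ∈ survivors G b π S ∨ ∃ a ∈ firstVertices π b S, G.Adj a v := by
  by_cases h : ∃ a ∈ firstVertices π b S, G.Adj a v
  · exact Or.inr h
  · push Not at h
    exact Or.inl (mem_filter.2 ⟨hv, hA, h⟩)

theorem notMem_survivors {b : ℕ} {π : Perm (Fin n)} {S : Finset (Fin n)} {v : Fin n}
    (hv : v ∈ firstVertices π b S) : v ∉ survivors G b π S := fun h => (mem_filter.1 h).2.1 hv

variable {b : ℕ} {S : Finset (Fin n)} {π : Perm (Fin n)} {c : Fin n → WithTop (Fin n)}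

theorem ExtendsRound.eq_center (h : ExtendsRound G b S π c) {u w : Fin n}
    (hu : u ∈ firstVertices π b S) (hw : w ∈ S) (hwA : w ∉ firstVertices π b S)
    (hc : c w = (π u : WithTop (Fin n))) : G.Adj u w := by
  rcases mem_survivors_or (G := G) hw hwA with hw' | ⟨v, hv, hvw⟩
  · obtain ⟨a, ha, hca⟩ := h.survived w hw'
    have : a = u := π.injective (WithTop.coe_injective (hca.symm.trans hc))
    exact absurd (this ▸ ha) (notMem_survivors hu)
  · obtain ⟨a, -, haw, -, -, hca⟩ := h.joined w hw hwA v hv hvw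
    have : a = u := π.injective (WithTop.coe_injective (hca.symm.trans hc))
    exact this ▸ haw

/-- A non-active vertex in the cluster of `u` is a positive neighbour of `u`, which rules out a
negative edge. Over a positive edge, `w` can only have joined another active neighbour. -/
theorem ExtendsRound.two_active_neighbors (h : ExtendsRound G b S π c) {u w : Fin n}
    (hu : u ∈ firstVertices π b S) (hw : w ∈ S) (hwA : w ∉ firstVertices π b S)
    (hd : Disagree G c u w) :
    G.Adj u w ∧ ∃ a ∈ firstVertices π b S, a ≠ u ∧ G.Adj a w := by
  rcases hd.2 with ⟨hadj, hne⟩ | ⟨hadj, heq⟩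
  · obtain ⟨a, ha, haw, -, -, hca⟩ := h.joined w hw hwA u hu hadj
    refine ⟨hadj, a, ha, fun hau => hne ?_, haw⟩
    rw [h.active u hu, hca, hau]
  · exact absurd (h.eq_center hu hw hwA (by rw [← heq, h.active u hu])) hadj

/-- Some active vertex is adjacent to `u` or `w`, so the earliest vertex `p` of the closed
neighbourhood is active, and whichever of `u`, `w` is adjacent to `p` joins `p`. If both are, their
edge must be negative; if only one is, they lie in different clusters and their edge must be
positive. -/
theorem ExtendsRound.exists_pivot (h : ExtendsRound G b S π c) {u w : Fin n} (hu : u ∈ S)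
    (hw : w ∈ S) (huA : u ∉ firstVertices π b S) (hwA : w ∉ firstVertices π b S)
    (hd : Disagree G c u w) (hs : ¬ (u ∈ survivors G b π S ∧ w ∈ survivors G b π S)) :
    ∃ p ∈ S, BadTriple G p u w ∧ rk S π p < b ∧ First (closedNbhd G S u w) π p := by
  obtain ⟨a, ha, haQ⟩ : ∃ a ∈ firstVertices π b S, a ∈ closedNbhd G S u w := by
    have : ∃ a ∈ firstVertices π b S, G.Adj a u ∨ G.Adj a w := by
      rcases mem_survivors_or (G := G) hu huA with h1 | ⟨a, ha, h1⟩
      · rcases mem_survivors_or (G := G) hw hwA with h2 | ⟨a, ha, h2⟩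
        · exact absurd ⟨h1, h2⟩ hs
        · exact ⟨a, ha, Or.inr h2⟩
      · exact ⟨a, ha, Or.inl h1⟩
    obtain ⟨a, ha, h1⟩ := this
    exact ⟨a, ha, mem_filter.2 ⟨(mem_firstVertices.1 ha).1, Or.inr (Or.inr h1)⟩⟩
  obtain ⟨p, hpQ, hmin⟩ := exists_min_image (closedNbhd G S u w) π ⟨a, haQ⟩
  obtain ⟨hpS, hp⟩ := mem_filter.1 hpQ
  have hpA : p ∈ firstVertices π b S :=
    mem_firstVertices.2 ⟨hpS, (rk_mono S (hmin a haQ)).trans_lt (mem_firstVertices.1 ha).2⟩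
  have hpu : p ≠ u := fun h' => huA (h' ▸ hpA)
  have hpw : p ≠ w := fun h' => hwA (h' ▸ hpA)
  have hcenter : ∀ x ∈ S, x ∉ firstVertices π b S → (∀ y, G.Adj y x → y ∈ S →
      y ∈ closedNbhd G S u w) → G.Adj p x → c x = (π p : WithTop (Fin n)) := by
    intro x hx hxA hxQ hpx
    obtain ⟨y, hy, hyx, hle, -, hcy⟩ := h.joined x hx hxA p hpA hpx
    have := hmin y (hxQ y hyx (mem_firstVertices.1 hy).1)
    rw [hcy, le_antisymm hle this]
  have hcu := hcenter u hu huA fun y hy hyS => mem_filter.2 ⟨hyS, by tauto⟩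
  have hcw := hcenter w hw hwA fun y hy hyS => mem_filter.2 ⟨hyS, by tauto⟩
  refine ⟨p, hpS, ⟨hpu, hd.1, hpw, ?_⟩, (mem_firstVertices.1 hpA).2, hmin⟩
  have hd2 := hd.2
  by_cases h1 : G.Adj p u <;> by_cases h2 : G.Adj p w
  · rcases hd2 with ⟨-, h3⟩ | ⟨h3, -⟩
    · exact absurd ((hcu h1).trans (hcw h2).symm) h3
    · exact Or.inr (Or.inl ⟨h1, h2, h3⟩)
  · refine Or.inl ⟨h1, ?_, h2⟩
    by_contra h3
    have h4 : c u = c w := (hd2.resolve_left fun h' => h3 h'.1).2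
    exact h2 (h.eq_center hpA hw hwA (h4 ▸ hcu h1))
  · refine Or.inr (Or.inr ⟨h2, ?_, h1⟩)
    by_contra h3
    have h4 : c u = c w := (hd2.resolve_left fun h' => h3 h'.1).2
    exact h1 (h.eq_center hpA hu huA (h4 ▸ hcw h2))
  · rcases hp with h3 | h3 | h3 | h3
    · exact absurd h3 hpu
    · exact absurd h3 hpw
    · exact absurd h3 h1
    · exact absurd h3 h2

end Round

/-! ### Pairs of active vertices -/

section ActivePairs

variable {n : ℕ} {G : SimpleGraph (Fin n)} [DecidableRel G.Adj] {F : Finset (Perm (Fin n))}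
  {S : Finset (Fin n)}

/-- Given that `v` is active, the `b - 1` other active vertices are equally likely to be any of the
other `S.card - 1` vertices. -/
theorem sum_cnt_active_le (hF : SwapInvariant F S) {v : Fin n} (hv : v ∈ S) {D : Finset (Fin n)}
    (hD : D ⊆ S.erase v) {Δ b : ℕ} {ε : ℝ} (hε : 0 ≤ ε) (hDΔ : D.card ≤ Δ) (hb1 : 1 ≤ b)
    (hbS : b ≤ S.card) (hΔ : (Δ : ℝ) * ((b : ℝ) - 1) ≤ ε * ((S.card : ℝ) - 1)) :
    ∑ w ∈ D, cnt F (fun π => rk S π v < b ∧ rk S π w < b) ≤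
      ε * cnt F (fun π => rk S π v < b) := by
  have hb : (0 : ℝ) ≤ (b : ℝ) - 1 := by
    have : (1 : ℝ) ≤ b := by exact_mod_cast hb1
    linarith
  have hcard : ((S.erase v).card : ℝ) = (S.card : ℝ) - 1 := by
    have := card_erase_add_one hv
    rw [← this]
    push_cast
    ring
  have hsum : ∑ w ∈ S.erase v, cnt F (fun π => rk S π v < b ∧ rk S π w < b) ≤
      ((b : ℝ) - 1) * cnt F (fun π => rk S π v < b) := by
    unfold cnt
    rw [sum_comm, mul_sum]
    refine sum_le_sum fun π _ => ?_
    by_cases h : rk S π v < b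
    · simp only [h, true_and, ind_of]
      rw [sum_ind_eq_card, mul_one, filter_erase]
      have h1 := card_erase_add_one (s := S.filter fun w => rk S π w < b) (a := v)
        (mem_filter.2 ⟨hv, h⟩)
      rw [card_rk_lt π hbS] at h1
      have h2 : (((S.filter fun w => rk S π w < b).erase v).card : ℝ) + 1 = b := by
        exact_mod_cast h1
      linarith
    · rw [ind_of_not h, mul_zero]
      exact (sum_eq_zero fun w _ => ind_of_not fun h' => h h'.1).le
  have hone : ∀ w ∈ S.erase v,
      ((S.card : ℝ) - 1) * cnt F (fun π => rk S π v < b ∧ rk S π w < b) ≤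
        ((b : ℝ) - 1) * cnt F (fun π => rk S π v < b) := by
    intro w hw
    refine le_trans ?_ hsum
    rw [← hcard, ← nsmul_eq_mul]
    refine card_nsmul_le_sum _ _ _ fun w' hw' => ?_
    obtain ⟨hwv, hw⟩ := mem_erase.1 hw
    obtain ⟨hwv', hw'⟩ := mem_erase.1 hw'
    refine cnt_le_of_swap hF hw hw' fun π _ h => ?_
    rw [rk_mul_swap hw hw', rk_mul_swap hw hw', swap_apply_left,
      swap_apply_of_ne_of_ne hwv.symm hwv'.symm] at h
    exact h
  rcases D.eq_empty_or_nonempty with rfl | ⟨w₀, hw₀⟩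
  · rw [sum_empty]
    exact mul_nonneg hε (cnt_nonneg _)
  · have hpos : (0 : ℝ) < (S.card : ℝ) - 1 := by
      rw [← hcard]
      exact_mod_cast card_pos.2 ⟨w₀, hD hw₀⟩
    refine le_of_mul_le_mul_left ?_ hpos
    calc ((S.card : ℝ) - 1) * ∑ w ∈ D, cnt F (fun π => rk S π v < b ∧ rk S π w < b)
        ≤ D.card • (((b : ℝ) - 1) * cnt F (fun π => rk S π v < b)) := by
          rw [mul_sum]
          exact sum_le_card_nsmul _ _ _ fun w hw => hone w (hD hw)
      _ ≤ Δ * (((b : ℝ) - 1) * cnt F (fun π => rk S π v < b)) := by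
          rw [nsmul_eq_mul]
          exact mul_le_mul_of_nonneg_right (by exact_mod_cast hDΔ)
            (mul_nonneg hb (cnt_nonneg _))
      _ = (Δ * ((b : ℝ) - 1)) * cnt F (fun π => rk S π v < b) := by ring
      _ ≤ (ε * ((S.card : ℝ) - 1)) * cnt F (fun π => rk S π v < b) :=
          mul_le_mul_of_nonneg_right hΔ (cnt_nonneg _)
      _ = _ := by ring

end ActivePairs

/-! ### The expected cost of one round -/

section RoundBound

variable {n : ℕ} {G : SimpleGraph (Fin n)} [DecidableRel G.Adj] {F : Finset (Perm (Fin n))}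
  {S : Finset (Fin n)}

/-- The number of ordered pairs of vertices of `S`, not both in `S'`, with whose edge the clustering
`c` disagrees. -/
noncomputable def decided {α : Type*} (G : SimpleGraph (Fin n)) (c : Fin n → α)
    (S S' : Finset (Fin n)) : ℝ :=
  ∑ u ∈ S, ∑ w ∈ S, ind (Disagree G c u w ∧ ¬ (u ∈ S' ∧ w ∈ S'))

/-- The case `batchSize G ε S = 1` stands apart because rounding up to `1` can violate the product
bound. -/
theorem batchSize_spec {ε : ℝ} (hε0 : 0 < ε) (hε1 : ε ≤ 1) (hS : S.Nonempty) :
    batchSize G ε S ≤ S.card ∧ (batchSize G ε S = 1 ∨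
      (maxDegreeOn G S : ℝ) * batchSize G ε S ≤ ε * S.card) := by
  have hs : (1 : ℝ) ≤ S.card := by exact_mod_cast hS.card_pos
  unfold batchSize
  split_ifs with h
  · exact ⟨le_rfl, Or.inr (by rw [h]; simp only [Nat.cast_zero, zero_mul]; positivity)⟩
  · have hΔ : (1 : ℝ) ≤ maxDegreeOn G S := by exact_mod_cast Nat.one_le_iff_ne_zero.2 h
    set x := ε * (S.card : ℝ) / (maxDegreeOn G S : ℝ) with hx
    have hx0 : 0 ≤ x := by positivity
    have hfl := Nat.floor_le hx0
    have hmul : (maxDegreeOn G S : ℝ) * x = ε * S.card := by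
      rw [hx]
      field_simp
    have hxs : x ≤ S.card := by
      rw [hx, div_le_iff₀ (by linarith)]
      nlinarith
    constructor
    · refine max_le hS.card_pos ?_
      exact_mod_cast hfl.trans hxs
    · rcases le_total ⌊x⌋₊ 1 with h1 | h1
      · exact Or.inl (max_eq_left h1)
      · right
        rw [max_eq_right h1, ← hmul]
        exact mul_le_mul_of_nonneg_left hfl (by linarith)

theorem sum_filter_eq_sum_ind_mul {α : Type*} (s : Finset α) (p : α → Prop) [DecidablePred p]
    (f : α → ℝ) : ∑ x ∈ s.filter p, f x = ∑ x ∈ s, ind (p x) * f x := by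
  rw [sum_filter]
  refine sum_congr rfl fun x _ => ?_
  by_cases h : p x <;> simp [ind, h]

theorem sum_pairs_eq {α : Type*} [DecidableEq α] (s : Finset α) (q : α → Prop) :
    ∑ u ∈ s, ∑ a ∈ s.erase u, ind (q u ∧ q a) =
      (∑ u ∈ s, ind (q u)) * (∑ u ∈ s, ind (q u) - 1) := by
  rw [sum_mul]
  refine sum_congr rfl fun u hu => ?_
  rw [← add_sum_erase s (fun u => ind (q u)) hu]
  simp only [ind_and, ← mul_sum]
  by_cases h : q u
  · rw [ind_of h]
    ring
  · rw [ind_of_not h, zero_mul, zero_mul]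

/-- If `k ≥ 1` elements satisfy `q`, this is `0 ≤ (k - 1) * (k - 2)`. -/
theorem two_mul_sum_ind_le {α : Type*} [DecidableEq α] (s : Finset α) (q : α → Prop) :
    2 * ∑ u ∈ s, ind (q u) ≤
      2 * ind (∃ u ∈ s, q u) + ∑ u ∈ s, ∑ a ∈ s.erase u, ind (q u ∧ q a) := by
  classical
  rw [sum_pairs_eq, sum_ind_eq_card]
  by_cases h : ∃ u ∈ s, q u
  · rw [ind_of h]
    obtain ⟨u, hu, hq⟩ := h
    have h1 : 1 ≤ (s.filter q).card := card_pos.2 ⟨u, mem_filter.2 ⟨hu, hq⟩⟩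
    rcases h1.eq_or_lt with h1 | h1
    · rw [← h1]
      norm_num
    · have h2 : (2 : ℝ) ≤ (s.filter q).card := by exact_mod_cast h1
      nlinarith
  · rw [filter_eq_empty_iff.2 fun u hu hq => h ⟨u, hu, hq⟩]
    simp [ind_nonneg]

/-- Let `X` be the number of active neighbours of `w`. Then `E[X(X-1)] ≤ ε E[X] ≤ E[X]`, and with
`2X ≤ 2·1[X ≥ 1] + X(X-1)` this gives `E[X] ≤ 2 P(X ≥ 1)`. So the cost is charged to the event that
`w` is clustered. -/
theorem sum_active_neighbors_le (hF : SwapInvariant F S) {w : Fin n} (hw : w ∈ S) {b : ℕ}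
    {ε : ℝ} (hε0 : 0 ≤ ε) (hε1 : ε ≤ 1) (hb1 : 1 ≤ b) (hbS : b ≤ S.card)
    (hΔ : (maxDegreeOn G S : ℝ) * ((b : ℝ) - 1) ≤ ε * ((S.card : ℝ) - 1)) :
    ∑ u ∈ S.filter (G.Adj w), ∑ a ∈ (S.filter (G.Adj w)).erase u,
        cnt F (fun π => rk S π u < b ∧ rk S π a < b) ≤
      2 * ε * cnt F (fun π => ∃ a ∈ S.filter (G.Adj w), rk S π a < b) := by
  set N := S.filter (G.Adj w) with hN
  have h1 : ∑ u ∈ N, ∑ a ∈ N.erase u, cnt F (fun π => rk S π u < b ∧ rk S π a < b) ≤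
      ε * ∑ u ∈ N, cnt F (fun π => rk S π u < b) := by
    rw [mul_sum]
    refine sum_le_sum fun u hu => ?_
    exact sum_cnt_active_le hF (mem_filter.1 hu).1 (erase_subset_erase u (filter_subset _ _)) hε0
      ((card_le_card (erase_subset _ _)).trans (card_adj_le_maxDegreeOn hw)) hb1 hbS hΔ
  have h2 : 2 * ∑ u ∈ N, cnt F (fun π => rk S π u < b) ≤
      2 * cnt F (fun π => ∃ a ∈ N, rk S π a < b) +
        ∑ u ∈ N, ∑ a ∈ N.erase u, cnt F (fun π => rk S π u < b ∧ rk S π a < b) := by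
    have h3 : ∑ u ∈ N, ∑ a ∈ N.erase u, cnt F (fun π => rk S π u < b ∧ rk S π a < b) =
        ∑ π ∈ F, ∑ u ∈ N, ∑ a ∈ N.erase u, ind (rk S π u < b ∧ rk S π a < b) := by
      unfold cnt
      rw [sum_comm]
      exact sum_congr rfl fun u _ => sum_comm
    rw [h3]
    unfold cnt
    rw [sum_comm, mul_sum, mul_sum, ← sum_add_distrib]
    exact sum_le_sum fun π _ => two_mul_sum_ind_le N fun u => rk S π u < b
  have h4 : 0 ≤ ∑ u ∈ N, cnt F (fun π => rk S π u < b) := sum_nonneg fun _ _ => cnt_nonneg _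
  have h5 : ε * ∑ u ∈ N, cnt F (fun π => rk S π u < b) ≤ ∑ u ∈ N, cnt F (fun π => rk S π u < b) :=
    mul_le_of_le_one_left h4 hε1
  have h6 : ∑ u ∈ N, cnt F (fun π => rk S π u < b) ≤
      2 * cnt F (fun π => ∃ a ∈ N, rk S π a < b) := by linarith
  calc _ ≤ _ := h1
    _ ≤ ε * (2 * cnt F (fun π => ∃ a ∈ N, rk S π a < b)) := mul_le_mul_of_nonneg_left h6 hε0
    _ = _ := by ring

theorem sum_ind_le_card_sub {b : ℕ} {π : Perm (Fin n)} (q : Fin n → Prop)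
    (hq : ∀ v ∈ S, q v → v ∉ survivors G b π S) :
    ∑ v ∈ S, ind (q v) ≤ (S.card : ℝ) - (survivors G b π S).card := by
  calc ∑ v ∈ S, ind (q v) ≤ ∑ v ∈ S, ind (v ∉ survivors G b π S) :=
        sum_le_sum fun v hv => ind_mono (hq v hv)
    _ = ((S \ survivors G b π S).card : ℝ) := by
        rw [sum_ind_eq_card, sdiff_eq_filter]
    _ = _ := by
        rw [card_sdiff_of_subset (survivors_subset b π S),
          Nat.cast_sub (card_le_card (survivors_subset b π S))]

theorem ExtendsRound.decided_le {b : ℕ} {π : Perm (Fin n)} {c : Fin n → WithTop (Fin n)}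
    (h : ExtendsRound G b S π c) :
    decided G c S (survivors G b π S) ≤
      ∑ u ∈ S, ∑ w ∈ S.filter (G.Adj u), ind (rk S π u < b ∧ rk S π w < b) +
      2 * (∑ w ∈ S, ∑ u ∈ S.filter (G.Adj w), ∑ a ∈ (S.filter (G.Adj w)).erase u,
        ind (rk S π u < b ∧ rk S π a < b)) +
      ∑ p ∈ S, ∑ u ∈ S, ∑ w ∈ S, ind (BadTriple G p u w) *
        ind (rk S π p < b ∧ First (closedNbhd G S u w) π p) := by
  set Y : Fin n → Fin n → ℝ := fun w u => ind (G.Adj w u) *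
    ∑ a ∈ (S.filter (G.Adj w)).erase u, ind (rk S π u < b ∧ rk S π a < b) with hY
  have hY0 : ∀ w u, 0 ≤ Y w u := fun w u =>
    mul_nonneg (ind_nonneg _) (sum_nonneg fun _ _ => ind_nonneg _)
  have h3 : ∑ p ∈ S, ∑ u ∈ S, ∑ w ∈ S, ind (BadTriple G p u w) *
        ind (rk S π p < b ∧ First (closedNbhd G S u w) π p) =
      ∑ u ∈ S, ∑ w ∈ S, ∑ p ∈ S, ind (BadTriple G p u w ∧
        rk S π p < b ∧ First (closedNbhd G S u w) π p) := by
    rw [sum_comm]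
    refine sum_congr rfl fun u _ => ?_
    rw [sum_comm]
    exact sum_congr rfl fun w _ => sum_congr rfl fun p _ => (ind_and _ _).symm
  have h2 : 2 * (∑ w ∈ S, ∑ u ∈ S.filter (G.Adj w), ∑ a ∈ (S.filter (G.Adj w)).erase u,
        ind (rk S π u < b ∧ rk S π a < b)) =
      ∑ u ∈ S, ∑ w ∈ S, Y w u + ∑ u ∈ S, ∑ w ∈ S, Y u w := by
    rw [sum_comm (f := fun u w => Y w u), ← two_mul]
    congr 1
    exact sum_congr rfl fun w _ => sum_filter_eq_sum_ind_mul _ _ _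
  have h1 : ∑ u ∈ S, ∑ w ∈ S.filter (G.Adj u), ind (rk S π u < b ∧ rk S π w < b) =
      ∑ u ∈ S, ∑ w ∈ S, ind (G.Adj u w ∧ rk S π u < b ∧ rk S π w < b) := by
    refine sum_congr rfl fun u _ => ?_
    rw [sum_filter_eq_sum_ind_mul]
    exact sum_congr rfl fun w _ => (ind_and _ _).symm
  rw [h1, h2, h3]
  simp only [← sum_add_distrib]
  unfold decided
  refine sum_le_sum fun u hu => sum_le_sum fun w hw => ?_
  have hX0 := ind_nonneg (G.Adj u w ∧ rk S π u < b ∧ rk S π w < b)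
  have hZ0 : 0 ≤ ∑ p ∈ S, ind (BadTriple G p u w ∧
      rk S π p < b ∧ First (closedNbhd G S u w) π p) := sum_nonneg fun _ _ => ind_nonneg _
  have hYwu := hY0 w u
  have hYuw := hY0 u w
  have hone : ∀ x y, x ∈ firstVertices π b S → y ∈ S → y ∉ firstVertices π b S →
      Disagree G c x y → 1 ≤ Y y x := by
    intro x y hx hy hyA hd
    obtain ⟨hadj, a, ha, hax, hay⟩ := h.two_active_neighbors hx hy hyA hd
    obtain ⟨haS, hab⟩ := mem_firstVertices.1 ha
    simp only [hY]
    rw [ind_of hadj.symm, one_mul,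
      ← ind_of (show rk S π x < b ∧ rk S π a < b from ⟨(mem_firstVertices.1 hx).2, hab⟩)]
    exact single_le_sum (f := fun a => ind (rk S π x < b ∧ rk S π a < b))
      (fun _ _ => ind_nonneg _) (mem_erase.2 ⟨hax, mem_filter.2 ⟨haS, hay.symm⟩⟩)
  by_cases hd : Disagree G c u w ∧ ¬ (u ∈ survivors G b π S ∧ w ∈ survivors G b π S)
  · rw [ind_of hd]
    obtain ⟨hd, hs⟩ := hd
    by_cases huA : u ∈ firstVertices π b S <;> by_cases hwA : w ∈ firstVertices π b S
    · have hne : c u ≠ c w := by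
        rw [h.active u huA, h.active w hwA]
        exact fun h' => hd.1 (π.injective (WithTop.coe_injective h'))
      have hadj : G.Adj u w := by
        by_contra h'
        exact hne (hd.2.resolve_left fun h'' => h' h''.1).2
      rw [ind_of ⟨hadj, (mem_firstVertices.1 huA).2, (mem_firstVertices.1 hwA).2⟩]
      linarith
    · have := hone u w huA hw hwA hd
      linarith
    · have := hone w u hwA hu huA hd.symm
      linarith
    · obtain ⟨p, hp, hp'⟩ := h.exists_pivot hu hw huA hwA hd hs
      have : (1 : ℝ) ≤ ∑ p ∈ S, ind (BadTriple G p u w ∧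
          rk S π p < b ∧ First (closedNbhd G S u w) π p) := by
        rw [← ind_of hp']
        exact single_le_sum (f := fun p => ind (BadTriple G p u w ∧
          rk S π p < b ∧ First (closedNbhd G S u w) π p)) (fun _ _ => ind_nonneg _) hp
      linarith
  · rw [ind_of_not hd]
    linarith

/-- A pair has at most one pivot, as each candidate lies in the closed neighbourhood and is first
there. An active pivot is adjacent to an endpoint, so the pair does not survive. -/
theorem sum_pivots_le_decided {α : Type*} (c : Fin n → α) (b : ℕ) (π : Perm (Fin n)) :
    ∑ p ∈ S, ∑ u ∈ S, ∑ w ∈ S, ind (BadTriple G p u w) * (ind (Disagree G c u w) *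
        ind (rk S π p < b ∧ First (closedNbhd G S u w) π p)) ≤
      decided G c S (survivors G b π S) := by
  rw [sum_comm]
  unfold decided
  refine sum_le_sum fun u hu => ?_
  rw [sum_comm]
  refine sum_le_sum fun w hw => ?_
  simp only [← ind_and]
  refine sum_ind_le (fun p hp h => ⟨h.2.1, fun hs => ?_⟩) fun p hp q hq h h' => ?_
  · obtain ⟨h1, -, h2, -⟩ := h
    have hpA : p ∈ firstVertices π b S := mem_firstVertices.2 ⟨hp, h2⟩
    have h3 := (mem_filter.1 hs.1).2.2 p hpA
    have h4 := (mem_filter.1 hs.2).2.2 p hpA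
    unfold BadTriple at h1
    tauto
  · exact π.injective (le_antisymm (h.2.2.2 q (h'.1.mem_closedNbhd hq))
      (h'.2.2.2 p (h.1.mem_closedNbhd hp)))

/-- The `5` is `1` for pairs of active vertices plus `2 * 2` for active neighbours, doubled because
ordered pairs are counted. -/
theorem sum_decided_le (hF : SwapInvariant F S) (hS : S.Nonempty) {ε : ℝ} (hε0 : 0 < ε)
    (hε1 : ε ≤ 1) {c : Perm (Fin n) → Fin n → WithTop (Fin n)}
    (hc : ∀ π ∈ F, ExtendsRound G (batchSize G ε S) S π (c π)) {α : Type*} (c' : Fin n → α) :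
    ∑ π ∈ F, decided G (c π) S (survivors G (batchSize G ε S) π S) ≤
      ∑ π ∈ F, ((3 + ε) * decided G c' S (survivors G (batchSize G ε S) π S) +
        5 * ε * ((S.card : ℝ) - (survivors G (batchSize G ε S) π S).card)) := by
  obtain ⟨hbS, hb⟩ := batchSize_spec (G := G) hε0 hε1 hS
  have hb1 := one_le_batchSize G ε S hS
  set b := batchSize G ε S
  set Δ := maxDegreeOn G S with hΔdef
  have hb1' : (1 : ℝ) ≤ b := by exact_mod_cast hb1
  have hbS' : (b : ℝ) ≤ S.card := by exact_mod_cast hbS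
  have hΔ : (Δ : ℝ) * ((b : ℝ) - 1) ≤ ε * ((S.card : ℝ) - 1) := by
    rcases hb with hb | hb
    · rw [hb]
      simp only [Nat.cast_one, sub_self, mul_zero]
      exact mul_nonneg hε0.le (by linarith)
    · rcases Nat.eq_zero_or_pos Δ with h0 | h0
      · rw [h0]
        simp only [Nat.cast_zero, zero_mul]
        exact mul_nonneg hε0.le (by linarith)
      · have : (1 : ℝ) ≤ Δ := by exact_mod_cast h0
        linarith
  -- The `b` subtracted on the left outweighs the `ε * b` subtracted on the right.
  have hb' : b = 1 ∨ ((Δ : ℝ) - 1) * b ≤ ε * ((S.card : ℝ) - b + 1) := by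
    refine hb.imp_right fun hb => ?_
    have : ε * (b : ℝ) ≤ b := mul_le_of_le_one_left (by linarith) hε1
    linarith
  have hT₁ : ∑ π ∈ F, ∑ u ∈ S, ∑ w ∈ S.filter (G.Adj u), ind (rk S π u < b ∧ rk S π w < b) ≤
      ε * ∑ π ∈ F, ((S.card : ℝ) - (survivors G b π S).card) := by
    calc _ = ∑ u ∈ S, ∑ w ∈ S.filter (G.Adj u), cnt F (fun π => rk S π u < b ∧ rk S π w < b) := by
          rw [sum_comm]
          exact sum_congr rfl fun u _ => sum_comm
      _ ≤ ∑ u ∈ S, ε * cnt F (fun π => rk S π u < b) := by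
          refine sum_le_sum fun u hu => sum_cnt_active_le hF hu (fun w hw => ?_) hε0.le
            (card_adj_le_maxDegreeOn hu) hb1 hbS hΔ
          exact mem_erase.2 ⟨(mem_filter.1 hw).2.ne', (mem_filter.1 hw).1⟩
      _ = ε * ∑ π ∈ F, ∑ u ∈ S, ind (rk S π u < b) := by
          rw [← mul_sum, sum_comm]
          rfl
      _ ≤ _ := by
          refine mul_le_mul_of_nonneg_left (sum_le_sum fun π _ => ?_) hε0.le
          exact sum_ind_le_card_sub _ fun v hv h => notMem_survivors (mem_firstVertices.2 ⟨hv, h⟩)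
  have hT₂ : ∑ π ∈ F, ∑ w ∈ S, ∑ u ∈ S.filter (G.Adj w), ∑ a ∈ (S.filter (G.Adj w)).erase u,
        ind (rk S π u < b ∧ rk S π a < b) ≤
      2 * ε * ∑ π ∈ F, ((S.card : ℝ) - (survivors G b π S).card) := by
    calc _ = ∑ w ∈ S, ∑ u ∈ S.filter (G.Adj w), ∑ a ∈ (S.filter (G.Adj w)).erase u,
            cnt F (fun π => rk S π u < b ∧ rk S π a < b) := by
          rw [sum_comm]
          refine sum_congr rfl fun w _ => ?_
          rw [sum_comm]
          exact sum_congr rfl fun u _ => sum_comm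
      _ ≤ ∑ w ∈ S, 2 * ε * cnt F (fun π => ∃ a ∈ S.filter (G.Adj w), rk S π a < b) :=
          sum_le_sum fun w hw => sum_active_neighbors_le hF hw hε0.le hε1 hb1 hbS hΔ
      _ = 2 * ε * ∑ π ∈ F, ∑ w ∈ S, ind (∃ a ∈ S.filter (G.Adj w), rk S π a < b) := by
          rw [← mul_sum, sum_comm]
          rfl
      _ ≤ _ := by
          refine mul_le_mul_of_nonneg_left (sum_le_sum fun π _ => ?_) (by linarith)
          refine sum_ind_le_card_sub _ fun v hv ⟨a, ha, hab⟩ hs => ?_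
          obtain ⟨haS, hav⟩ := mem_filter.1 ha
          exact (mem_filter.1 hs).2.2 a (mem_firstVertices.2 ⟨haS, hab⟩) hav.symm
  have hswap : ∀ g : Fin n → Fin n → Fin n → Perm (Fin n) → ℝ,
      ∑ π ∈ F, ∑ p ∈ S, ∑ u ∈ S, ∑ w ∈ S, g p u w π =
        ∑ p ∈ S, ∑ u ∈ S, ∑ w ∈ S, ∑ π ∈ F, g p u w π := by
    intro g
    rw [sum_comm]
    refine sum_congr rfl fun p _ => ?_
    rw [sum_comm]
    exact sum_congr rfl fun u _ => sum_comm
  have hT₃ : ∑ π ∈ F, ∑ p ∈ S, ∑ u ∈ S, ∑ w ∈ S, ind (BadTriple G p u w) *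
        ind (rk S π p < b ∧ First (closedNbhd G S u w) π p) ≤
      (3 + ε) * ∑ π ∈ F, decided G c' S (survivors G b π S) := by
    calc _ = ∑ p ∈ S, ∑ u ∈ S, ∑ w ∈ S,
            ind (BadTriple G p u w) * pivotCount G F S b p u w := by
          rw [hswap]
          simp only [pivotCount, cnt, mul_sum]
      _ ≤ _ := sum_pivotCount_le hF hε0.le hb1 hbS hb' c'
      _ = (3 + ε) * ∑ π ∈ F, ∑ p ∈ S, ∑ u ∈ S, ∑ w ∈ S, ind (BadTriple G p u w) *
            (ind (Disagree G c' u w) *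
              ind (rk S π p < b ∧ First (closedNbhd G S u w) π p)) := by
          rw [hswap]
          simp only [pivotCount, cnt, mul_sum]
      _ ≤ _ := mul_le_mul_of_nonneg_left
          (sum_le_sum fun π _ => sum_pivots_le_decided c' b π) (by linarith)
  calc _ ≤ _ := sum_le_sum fun π hπ => (hc π hπ).decided_le
    _ = _ := by rw [sum_add_distrib, sum_add_distrib, ← mul_sum]
    _ ≤ _ := add_le_add (add_le_add hT₁ (mul_le_mul_of_nonneg_left hT₂ zero_le_two)) hT₃
    _ = _ := by
        rw [sum_add_distrib, ← mul_sum, ← mul_sum]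
        ring

end RoundBound

/-! ### The run of the algorithm -/

section Iteration

variable {n : ℕ} (G : SimpleGraph (Fin n)) [DecidableRel G.Adj] (ε : ℝ)

/-- The set of unclustered vertices after `r` rounds of ClusterWild!. -/
noncomputable def aliveAfter (r : ℕ) (π : Perm (Fin n)) : Finset (Fin n) :=
  ((round G ε π)^[r] (initState n)).alive

variable {G ε} {S A : Finset (Fin n)} {π : Perm (Fin n)}

theorem updateIDs_of_mem {ids : Fin n → WithTop (Fin n)} {u : Fin n} (hu : u ∈ A) :
    updateIDs G π S A ids u = (π u : WithTop (Fin n)) := if_pos hu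

theorem updateIDs_of_adj {ids : Fin n → WithTop (Fin n)} {u v : Fin n} (hu : u ∈ S)
    (huA : u ∉ A) (hid : ids u = ⊤) (hv : v ∈ A) (hvu : G.Adj v u) :
    ∃ a ∈ A, G.Adj a u ∧ π a ≤ π v ∧ (∀ a' ∈ A, G.Adj a' u → π a ≤ π a') ∧
      updateIDs G π S A ids u = (π a : WithTop (Fin n)) := by
  obtain ⟨a, ha, hmin⟩ := exists_min_image (A.filter fun v => G.Adj v u) π
    ⟨v, mem_filter.2 ⟨hv, hvu⟩⟩
  obtain ⟨haA, hau⟩ := mem_filter.1 ha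
  refine ⟨a, haA, hau, hmin v (mem_filter.2 ⟨hv, hvu⟩),
    fun a' ha' h => hmin a' (mem_filter.2 ⟨ha', h⟩), ?_⟩
  unfold updateIDs
  rw [if_neg huA, if_pos hu, hid, min_eq_right le_top]
  refine le_antisymm (inf_le (f := fun v => (π v : WithTop (Fin n))) ha)
    (Finset.le_inf fun b hb => ?_)
  exact WithTop.coe_le_coe.2 (hmin b hb)

theorem updateIDs_eq_top_iff {ids : Fin n → WithTop (Fin n)} {u : Fin n} (hu : u ∈ S)
    (hid : ids u = ⊤) :
    updateIDs G π S A ids u = ⊤ ↔ u ∉ A ∧ ∀ a ∈ A, ¬ G.Adj a u := by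
  constructor
  · intro h
    have huA : u ∉ A := fun huA => by
      rw [updateIDs_of_mem huA] at h
      exact WithTop.coe_ne_top h
    refine ⟨huA, fun a ha hau => ?_⟩
    obtain ⟨b, -, -, -, -, hb⟩ := updateIDs_of_adj (π := π) hu huA hid ha hau
    rw [hb] at h
    exact WithTop.coe_ne_top h
  · rintro ⟨huA, h⟩
    unfold updateIDs
    rw [if_neg huA, if_pos hu, hid, filter_eq_empty_iff.2 h, inf_empty, min_self]

theorem clusterID_eq_top (r : ℕ) {v : Fin n} (hv : v ∈ aliveAfter G ε r π) :
    ((round G ε π)^[r] (initState n)).clusterID v = ⊤ := by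
  unfold aliveAfter at hv
  cases r with
  | zero => rfl
  | succ r =>
    rw [Function.iterate_succ_apply'] at hv ⊢
    exact (mem_filter.1 hv).2

theorem clusterID_succ (r : ℕ) (π : Perm (Fin n)) :
    ((round G ε π)^[r + 1] (initState n)).clusterID =
      updateIDs G π (aliveAfter G ε r π)
        (firstVertices π (batchSize G ε (aliveAfter G ε r π)) (aliveAfter G ε r π))
        ((round G ε π)^[r] (initState n)).clusterID := by
  rw [Function.iterate_succ_apply']
  rfl

theorem aliveAfter_zero (π : Perm (Fin n)) : aliveAfter G ε 0 π = univ := rfl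

theorem aliveAfter_self (π : Perm (Fin n)) : aliveAfter G ε n π = ∅ := round_iterate_alive G ε π

theorem aliveAfter_succ (r : ℕ) (π : Perm (Fin n)) :
    aliveAfter G ε (r + 1) π =
      survivors G (batchSize G ε (aliveAfter G ε r π)) π (aliveAfter G ε r π) := by
  have h : aliveAfter G ε (r + 1) π = (aliveAfter G ε r π).filter fun v =>
      ((round G ε π)^[r + 1] (initState n)).clusterID v = ⊤ := by
    unfold aliveAfter
    rw [Function.iterate_succ_apply']
    rfl
  rw [h, clusterID_succ]
  exact filter_congr fun v hv => updateIDs_eq_top_iff hv (clusterID_eq_top r hv)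

/-- Neither vertex is active, so the exchange happens behind the active prefix, and the active set
determines the survivors. -/
theorem survivors_mul_swap {b : ℕ} {x y : Fin n} (hx : x ∈ survivors G b π S)
    (hy : y ∈ survivors G b π S) : survivors G b (π * swap x y) S = survivors G b π S := by
  have hxS := survivors_subset b π S hx
  have hyS := survivors_subset b π S hy
  have hxA := (mem_filter.1 hx).2.1
  have hyA := (mem_filter.1 hy).2.1
  have h : firstVertices (π * swap x y) b S = firstVertices π b S := by
    ext v
    rw [mem_firstVertices, rk_mul_swap hxS hyS, mem_firstVertices]
    rw [mem_firstVertices] at hxA hyA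
    rcases eq_or_ne v x with rfl | hvx
    · rw [swap_apply_left]
      tauto
    rcases eq_or_ne v y with rfl | hvy
    · rw [swap_apply_right]
      tauto
    rw [swap_apply_of_ne_of_ne hvx hvy]
  unfold survivors
  rw [h]

theorem aliveAfter_mul_swap (r : ℕ) {x y : Fin n} (hx : x ∈ aliveAfter G ε r π)
    (hy : y ∈ aliveAfter G ε r π) : aliveAfter G ε r (π * swap x y) = aliveAfter G ε r π := by
  induction r with
  | zero => rw [aliveAfter_zero, aliveAfter_zero]
  | succ r ih =>
    rw [aliveAfter_succ] at hx hy
    rw [aliveAfter_succ, aliveAfter_succ,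
      ih (survivors_subset _ _ _ hx) (survivors_subset _ _ _ hy), survivors_mul_swap hx hy]

theorem swapInvariant_aliveAfter (r : ℕ) (S : Finset (Fin n)) :
    SwapInvariant (univ.filter fun π => aliveAfter G ε r π = S) S := by
  intro π hπ x hx y hy
  obtain rfl := (mem_filter.1 hπ).2
  exact mem_filter.2 ⟨mem_univ _, aliveAfter_mul_swap r hx hy⟩

theorem clusterWild_eq_clusterID {r : ℕ} (hr : r ≤ n) {u : Fin n}
    (hu : u ∉ aliveAfter G ε r π) :
    clusterWild G ε π u = ((round G ε π)^[r] (initState n)).clusterID u := by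
  have key : ∀ k, r ≤ k → u ∉ aliveAfter G ε k π ∧
      ((round G ε π)^[k] (initState n)).clusterID u =
        ((round G ε π)^[r] (initState n)).clusterID u := by
    intro k hk
    induction k, hk using Nat.le_induction with
    | base => exact ⟨hu, rfl⟩
    | succ k _ ih =>
      obtain ⟨h1, h2⟩ := ih
      refine ⟨fun h => ?_, ?_⟩
      · rw [aliveAfter_succ] at h
        exact h1 (survivors_subset _ _ _ h)
      · rw [clusterID_succ, ← h2]
        unfold updateIDs
        rw [if_neg fun h => h1 (mem_firstVertices.1 h).1, if_neg h1]
  exact (key n hr).2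

theorem clusterWild_of_active {r : ℕ} (hr : r < n) {u : Fin n}
    (hu : u ∈ firstVertices π (batchSize G ε (aliveAfter G ε r π)) (aliveAfter G ε r π)) :
    clusterWild G ε π u = (π u : WithTop (Fin n)) := by
  rw [clusterWild_eq_clusterID (r := r + 1) hr (by
    rw [aliveAfter_succ]
    exact notMem_survivors (G := G) hu), clusterID_succ, updateIDs_of_mem hu]

theorem clusterWild_of_adj_active {r : ℕ} (hr : r < n) {u v : Fin n}
    (hu : u ∈ aliveAfter G ε r π)
    (huA : u ∉ firstVertices π (batchSize G ε (aliveAfter G ε r π)) (aliveAfter G ε r π))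
    (hv : v ∈ firstVertices π (batchSize G ε (aliveAfter G ε r π)) (aliveAfter G ε r π))
    (hvu : G.Adj v u) :
    ∃ a ∈ firstVertices π (batchSize G ε (aliveAfter G ε r π)) (aliveAfter G ε r π),
      G.Adj a u ∧ π a ≤ π v ∧
      (∀ a' ∈ firstVertices π (batchSize G ε (aliveAfter G ε r π)) (aliveAfter G ε r π),
        G.Adj a' u → π a ≤ π a') ∧ clusterWild G ε π u = (π a : WithTop (Fin n)) := by
  rw [clusterWild_eq_clusterID (r := r + 1) hr (by
    rw [aliveAfter_succ]
    exact fun h => (mem_filter.1 h).2.2 v hv hvu), clusterID_succ]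
  exact updateIDs_of_adj hu huA (clusterID_eq_top r hu) hv hvu

/-- Backward induction from round `n`, when nothing is alive. It ensures that clusters of later
rounds do not reuse a label of an earlier one. -/
theorem exists_center {r : ℕ} (hr : r ≤ n) {u : Fin n} (hu : u ∈ aliveAfter G ε r π) :
    ∃ a ∈ aliveAfter G ε r π, clusterWild G ε π u = (π a : WithTop (Fin n)) := by
  induction hr using Nat.decreasingInduction with
  | self =>
    rw [aliveAfter_self] at hu
    exact absurd hu (notMem_empty u)
  | of_succ r hr ih =>
    rw [aliveAfter_succ] at ih
    by_cases huA : u ∈ firstVertices π (batchSize G ε (aliveAfter G ε r π)) (aliveAfter G ε r π)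
    · exact ⟨u, hu, clusterWild_of_active hr huA⟩
    · rcases mem_survivors_or (G := G) hu huA with hs | ⟨v, hv, hvu⟩
      · obtain ⟨a, ha, h⟩ := ih hs
        exact ⟨a, survivors_subset (G := G) _ _ _ ha, h⟩
      · obtain ⟨a, ha, -, -, -, h⟩ := clusterWild_of_adj_active hr hu huA hv hvu
        exact ⟨a, (mem_filter.1 ha).1, h⟩

theorem extendsRound_clusterWild {r : ℕ} (hr : r < n) (π : Perm (Fin n)) :
    ExtendsRound G (batchSize G ε (aliveAfter G ε r π)) (aliveAfter G ε r π) π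
      (clusterWild G ε π) where
  active _ hu := clusterWild_of_active hr hu
  joined _ hu huA _ hv hvu := clusterWild_of_adj_active hr hu huA hv hvu
  survived u hu := by
    rw [← aliveAfter_succ] at hu ⊢
    exact exists_center hr hu

end Iteration

/-! ### Summing over the rounds -/

section Total

variable {n : ℕ} {G : SimpleGraph (Fin n)}

theorem decided_add {α : Type*} (c : Fin n → α) {S S' : Finset (Fin n)} (h : S' ⊆ S) :
    decided G c S S' + decided G c S' ∅ = decided G c S ∅ := by
  have h1 : decided G c S' ∅ =
      ∑ u ∈ S, ∑ w ∈ S, ind (Disagree G c u w ∧ u ∈ S' ∧ w ∈ S') := by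
    unfold decided
    rw [← inter_eq_right.2 h, ← filter_mem_eq_inter, sum_filter_eq_sum_ind_mul]
    refine sum_congr rfl fun u _ => ?_
    rw [sum_filter_eq_sum_ind_mul, mul_sum]
    refine sum_congr rfl fun w _ => ?_
    rw [← ind_and, ← ind_and]
    exact ind_congr (by simp only [mem_filter, notMem_empty]; tauto)
  rw [h1]
  unfold decided
  simp only [← sum_add_distrib]
  refine sum_congr rfl fun u _ => sum_congr rfl fun w _ => ?_
  by_cases hs : u ∈ S' ∧ w ∈ S' <;> by_cases hd : Disagree G c u w <;> simp [ind, hs, hd]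

theorem decided_univ_empty [DecidableRel G.Adj] {α : Type*} [DecidableEq α] (c : Fin n → α) :
    decided G c univ ∅ = 2 * disagreements G c := by
  classical
  have h1 : ∀ u w : Fin n,
      ind (Disagree G c u w ∧ ¬ (u ∈ (∅ : Finset (Fin n)) ∧ w ∈ (∅ : Finset (Fin n)))) =
      ind (u < w ∧ Disagree G c u w) + ind (w < u ∧ Disagree G c w u) := by
    intro u w
    have hs : Disagree G c w u ↔ Disagree G c u w := ⟨Disagree.symm, Disagree.symm⟩
    rw [ind_congr (and_congr_right' hs)]
    rcases lt_trichotomy u w with h | h | h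
    · simp [ind, h, h.not_gt]
    · simp [ind, h, Disagree]
    · simp [ind, h, h.not_gt]
  have h2 : ∑ u, ∑ w, ind (u < w ∧ Disagree G c u w) = disagreements G c := by
    rw [← Fintype.sum_prod_type' (f := fun u w => ind (u < w ∧ Disagree G c u w)), sum_ind_eq_card]
    unfold disagreements
    rw [Nat.cast_inj]
    congr 1
    ext p
    refine mem_filter.trans (Iff.trans ?_ mem_filter.symm)
    exact and_congr_right' ⟨fun h => ⟨h.1, h.2.2⟩, fun h => ⟨h.1, h.1.ne, h.2⟩⟩
  unfold decided
  simp only [h1, sum_add_distrib]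
  rw [sum_comm (f := fun u w => ind (w < u ∧ Disagree G c w u)), h2]
  ring

/-- Every pair is decided in exactly one round, so the sum telescopes; the `2` counts ordered pairs.
-/
theorem sum_decided_aliveAfter [DecidableRel G.Adj] {α : Type*} [DecidableEq α] (ε : ℝ)
    (π : Perm (Fin n)) (c : Fin n → α) :
    ∑ r ∈ range n, decided G c (aliveAfter G ε r π)
      (survivors G (batchSize G ε (aliveAfter G ε r π)) π (aliveAfter G ε r π)) =
      2 * disagreements G c := by
  rw [← decided_univ_empty, ← aliveAfter_zero (G := G) (ε := ε) π]
  have h : decided G c (aliveAfter G ε n π) ∅ = 0 := by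
    rw [aliveAfter_self]
    simp [decided]
  rw [← sub_zero (decided G c (aliveAfter G ε 0 π) ∅), ← h,
    ← sum_range_sub' (fun r => decided G c (aliveAfter G ε r π) ∅)]
  refine sum_congr rfl fun r _ => ?_
  rw [aliveAfter_succ, ← decided_add c (survivors_subset (G := G) _ π (aliveAfter G ε r π)),
    add_sub_cancel_right]

theorem sum_card_aliveAfter [DecidableRel G.Adj] (ε : ℝ) (π : Perm (Fin n)) :
    ∑ r ∈ range n, (((aliveAfter G ε r π).card : ℝ) -
      (survivors G (batchSize G ε (aliveAfter G ε r π)) π (aliveAfter G ε r π)).card) = n := by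
  simp only [← aliveAfter_succ]
  rw [sum_range_sub' (fun r => ((aliveAfter G ε r π).card : ℝ)), aliveAfter_self, aliveAfter_zero]
  simp

/-- Conditioning on the set alive before the round: on each fibre `sum_decided_le` applies. -/
theorem sum_round_le [DecidableRel G.Adj] {ε : ℝ} (hε0 : 0 < ε) (hε1 : ε ≤ 1) {r : ℕ} (hr : r < n)
    {α : Type*} (c : Fin n → α) :
    ∑ π : Perm (Fin n), decided G (clusterWild G ε π) (aliveAfter G ε r π)
        (survivors G (batchSize G ε (aliveAfter G ε r π)) π (aliveAfter G ε r π)) ≤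
      ∑ π : Perm (Fin n), ((3 + ε) * decided G c (aliveAfter G ε r π)
          (survivors G (batchSize G ε (aliveAfter G ε r π)) π (aliveAfter G ε r π)) +
        5 * ε * (((aliveAfter G ε r π).card : ℝ) -
          (survivors G (batchSize G ε (aliveAfter G ε r π)) π (aliveAfter G ε r π)).card)) := by
  rw [← sum_fiberwise univ (fun π => aliveAfter G ε r π),
    ← sum_fiberwise univ (fun π => aliveAfter G ε r π) (fun π =>
      ((3 + ε) * decided G c (aliveAfter G ε r π)
          (survivors G (batchSize G ε (aliveAfter G ε r π)) π (aliveAfter G ε r π)) +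
        5 * ε * (((aliveAfter G ε r π).card : ℝ) -
          (survivors G (batchSize G ε (aliveAfter G ε r π)) π (aliveAfter G ε r π)).card)))]
  refine sum_le_sum fun S _ => ?_
  have hfib : ∀ f : Finset (Fin n) → Perm (Fin n) → ℝ,
      ∑ π with aliveAfter G ε r π = S, f (aliveAfter G ε r π) π =
        ∑ π with aliveAfter G ε r π = S, f S π := fun f =>
    sum_congr rfl fun π hπ => by rw [(mem_filter.1 hπ).2]
  rw [hfib (fun S π => decided G (clusterWild G ε π) S (survivors G (batchSize G ε S) π S)),
    hfib (fun S π => (3 + ε) * decided G c S (survivors G (batchSize G ε S) π S) +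
      5 * ε * ((S.card : ℝ) - (survivors G (batchSize G ε S) π S).card))]
  rcases S.eq_empty_or_nonempty with rfl | hS
  · simp [decided, survivors]
  · refine sum_decided_le (swapInvariant_aliveAfter r S) hS hε0 hε1 (fun π hπ => ?_) c
    have := extendsRound_clusterWild (G := G) (ε := ε) hr π
    rwa [(mem_filter.1 hπ).2] at this

theorem expectedCost_le [DecidableRel G.Adj] {ε : ℝ} (hε0 : 0 < ε) (hε1 : ε ≤ 1) :
    expectedCost G ε ≤ (3 + ε) * (OPT G : ℝ) + 5 / 2 * (ε * n) := by
  obtain ⟨c, -, hc⟩ := exists_mem_eq_inf' (s := (univ : Finset (Fin n → Fin n)))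
    ⟨id, mem_univ id⟩ (fun c : Fin n → Fin n => disagreements G c)
  have hc : OPT G = disagreements G c := hc
  have hpos : (0 : ℝ) < Fintype.card (Perm (Fin n)) := by exact_mod_cast Fintype.card_pos
  unfold expectedCost
  rw [div_le_iff₀ hpos, hc]
  have h := sum_le_sum fun r hr => sum_round_le (G := G) hε0 hε1 (mem_range.1 hr : r < n) c
  rw [sum_comm, sum_comm (s := range n)] at h
  simp only [sum_add_distrib, ← mul_sum, sum_decided_aliveAfter, sum_card_aliveAfter] at h
  rw [sum_const, sum_const, nsmul_eq_mul, nsmul_eq_mul, card_univ] at h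
  linarith

end Total

end CorrelationClustering

theorem theorem3 :
    ∃ C : ℝ, ∀ (ε : ℝ), 0 < ε → ε ≤ 1 →
      ∀ (n : ℕ) (G : SimpleGraph (Fin n)) [DecidableRel G.Adj],
        CorrelationClustering.expectedCost G ε
          ≤ (3 + ε) * (CorrelationClustering.OPT G : ℝ) + C * (ε * (n : ℝ) * (Real.log (n : ℝ)) ^ 2) := by
  -- For `n ≥ 2` the bound `1 / 4 ≤ Real.log n ^ 2` gives `5 / 2 ≤ 10 * Real.log n ^ 2`. For `n < 2`
  -- the logarithmic term vanishes, but there are no pairs.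
  refine ⟨10, fun ε hε0 hε1 n G _ => ?_⟩
  rcases Nat.lt_or_ge n 2 with hn | hn
  · have h : CorrelationClustering.expectedCost G ε = 0 := by
      have : ∀ π, CorrelationClustering.disagreements G
          (CorrelationClustering.clusterWild G ε π) = 0 := fun π =>
        Finset.card_eq_zero.2 <| Finset.filter_eq_empty_iff.2 fun p _ hp => by
          have := hp.1
          omega
      simp [CorrelationClustering.expectedCost, this]
    rw [h]
    positivity
  · refine (CorrelationClustering.expectedCost_le hε0 hε1).trans (add_le_add_right ?_ _)
    have h1 : (1 / 2 : ℝ) ≤ Real.log n := by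
      have h2 : Real.log 2 ≤ Real.log n := Real.log_le_log two_pos (by exact_mod_cast hn)
      have := Real.log_two_gt_d9
      linarith
    have h3 : (1 / 4 : ℝ) ≤ Real.log n ^ 2 := by nlinarith
    have h4 : 0 ≤ ε * (n : ℝ) := by positivity
    nlinarith
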